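/- Let $F$ be a field. A factorization inverse system over $F$ is a finite inverse system $\mathcal F=\{F_i\}_{i\in I}$ of fields and inclusions whose inverse limit in the category of rings is $F$, and whose finite partially ordered index set $I$ (with an inclusion $F_i\hookrightarrow F_j$ given for each $i\succ j$) is a disjoint union $I=I_v\sqcup I_e$ such that for each $k\in I_e$ there are exactly two elements $i\in I_v$ with $i\succ k$, and there are no other relations in $I$. A vector space patching problem for $\mathcal F$ consists of finite dimensional $F_i$-vector spaces $V_i$ ($i\in I$) together with $F_j$-linear isomorphisms $\nu_{i,j}\colon V_i\otimes_{F_i}F_j\to V_j$ for all $i\succ j$; a morphism is a family of $F_i$-linear maps compatible with the $\nu_{i,j}$. Base change defines a functor $\beta\colon \mathrm{Vect}(F)\to\mathrm{PP}(\mathcal F)$ from finite dimensional $F$-vector spaces to vector space patching problems. Let $G$ be a linear algebraic group over $F$, i.e. a smooth affine group scheme of finite type over $F$. For a field extension $E/F$, a $G$-torsor over $E$ is a non-empty $E$-scheme $H$ with a right action of $G_E$ such that $(h,g)\mapsto(h,h\cdot g)$ is an isomorphism $H\times_E G_E\to H\times_E H$; morphisms are $G_E$-equivariant morphisms of $E$-schemes.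 A $G$-torsor patching problem for $\mathcal F$ consists of $G$-torsors $\mathcal T_i$ over $F_i$ ($i\in I$) together with isomorphisms of $G$-torsors $\nu_{i,j}\colon\mathcal T_i\times_{F_i}F_j\to\mathcal T_j$ over $F_j$ for all $i\succ j$; a morphism is a family of morphisms of torsors compatible with the $\nu_{i,j}$. Base change defines a functor from $G$-torsors over $F$ to $G$-torsor patching problems for $\mathcal F$; a solution of a patching problem is a $G$-torsor over $F$ whose induced patching problem is isomorphic to the given one. Theorem. Let $\mathcal F=\{F_i\}_{i\in I}$ be a factorization inverse system over a field $F$, let $G$ be a linear algebraic group over $F$, and suppose that $\beta\colon\mathrm{Vect}(F)\to\mathrm{PP}(\mathcal F)$ is an equivalence of categories. Then the base change functor from the category of $G$-torsors over $F$ to the category of $G$-torsor patching problems for $\mathcal F$ is an equivalence of categories. In particular, every $G$-torsor patching problem has a solution, and it is unique up to isomorphism. Moreover, if $\mathcal T$ is a solution of the patching problem $(\{\mathcal T_i\},\{\nu_{i,j}\})$, with a given isomorphism between the induced patching problem and the given one, then $\mathcal T$ and all $\mathcal T_i$ are affine, and the coordinate ring of $\mathcal T$, with the maps induced by $\mathcal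 T_i\cong\mathcal T\times_F F_i\to\mathcal T$, is the inverse limit of the coordinate rings of the $\mathcal T_i$ with respect to the maps induced by $\mathcal T_j\cong\mathcal T_i\times_{F_i}F_j\to\mathcal T_i$ for $i\succ j$. -/

import Mathlib

open CategoryTheory Limits AlgebraicGeometry MonoidalCategory CartesianMonoidalCategory

universe u

noncomputable section

namespace TorsorPatching

/-! ### Factorization inverse systems -/

/-- `B`, with the maps `π i : B → A i`, is the inverse limit of the system of rings
`(A i, res)`, where there is a transition map `A i → A j` whenever `i > j`. -/
def IsInverseLimit {I : Type} [PartialOrder I] {A : I → Type u} [∀ i, CommRing (A i)]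
    (res : ∀ {i j : I}, i > j → (A i →+* A j)) {B : Type u} [CommRing B]
    (π : ∀ i, B →+* A i) : Prop :=
  (∀ {i j : I} (h : i > j), (res h).comp (π i) = π j) ∧
    ∀ a : ∀ i, A i, (∀ {i j : I} (h : i > j), res h (a i) = a j) → ∃! b : B, ∀ i, π i b = a i

/-- A factorization inverse system over `F`, indexed by a finite partially ordered set `I`:
for `i > j` there is an inclusion `K i ↪ K j`.  The set `I` is the disjoint union of `Iv` and `Ie`;
each `k ∈ Ie` lies below exactly two elements of `Iv`, and there are no other relations.  In
particular there are no chains `i > j > k`, so no compatibility between inclusions is needed. -/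
structure FactorizationInverseSystem (F : Type u) [Field F] (I : Type) [Finite I]
    [PartialOrder I] where
  K : I → Type u
  [field : ∀ i, Field (K i)]
  [algebra : ∀ i, Algebra F (K i)]
  incl : ∀ {i j : I}, i > j → (K i →ₐ[F] K j)
  isInverseLimit : IsInverseLimit (fun {_ _} h => (incl h).toRingHom)
    (fun i => algebraMap F (K i))
  exists_partition : ∃ Iv Ie : Set I, Disjoint Iv Ie ∧ Iv ∪ Ie = Set.univ ∧
    (∀ k ∈ Ie, {i | i ∈ Iv ∧ i > k}.ncard = 2) ∧ ∀ i j : I, i > j → i ∈ Iv ∧ j ∈ Ie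

attribute [instance] FactorizationInverseSystem.field FactorizationInverseSystem.algebra

variable {F : Type u} [Field F] {I : Type} [Finite I] [PartialOrder I]

/-! ### Vector space patching problems -/

/-- A vector space patching problem: finite dimensional `K i`-vector spaces `V i` and isomorphisms
`V i ⊗_{K i} K j ≅ V j` of `K j`-vector spaces for `i > j`. -/
structure VectPatchingProblem (S : FactorizationInverseSystem F I) where
  V : ∀ i, FGModuleCat.{u} (S.K i)
  ν : ∀ {i j : I} (h : i > j),
    (ModuleCat.extendScalars (S.incl h).toRingHom).obj (V i).obj ≅ (V j).obj

namespace VectPatchingProblem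

variable {S : FactorizationInverseSystem F I}

/-- A morphism of patching problems: linear maps over all the `K i`, compatible with the `ν`. -/
@[ext]
structure Hom (P Q : VectPatchingProblem S) where
  hom : ∀ i, P.V i ⟶ Q.V i
  comm : ∀ {i j : I} (h : i > j),
    (ModuleCat.extendScalars (S.incl h).toRingHom).map (hom i).hom ≫ (Q.ν h).hom =
      (P.ν h).hom ≫ (hom j).hom

instance : Category (VectPatchingProblem S) where
  Hom := Hom
  id P := ⟨fun _ => 𝟙 _, fun h => by simp⟩
  comp f g := ⟨fun i => f.hom i ≫ g.hom i, fun h => by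
    rw [ObjectProperty.FullSubcategory.comp_hom, ObjectProperty.FullSubcategory.comp_hom,
      Functor.map_comp, Category.assoc, g.comm h, ← Category.assoc, f.comm h, Category.assoc]⟩

end VectPatchingProblem

/-- Extension of scalars of finite dimensional vector spaces. -/
def extendFG {K L : Type u} [Field K] [Field L] (f : K →+* L) :
    FGModuleCat.{u} K ⥤ FGModuleCat.{u} L :=
  ObjectProperty.lift _ (ObjectProperty.ι _ ⋙ ModuleCat.extendScalars f) fun V => by
    let := f.toAlgebra
    have : Module.Finite K V.obj := V.property
    exact inferInstanceAs (Module.Finite L (TensorProduct K L V.obj))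

/-- Transitivity of extension of scalars: `(V ⊗_K L) ⊗_L M ≅ V ⊗_K M`. -/
def extendScalarsTrans {K L M : Type u} [Field K] [Field L] [Field M] (f : K →+* L) (g : L →+* M)
    (h : K →+* M) (w : g.comp f = h) :
    ModuleCat.extendScalars.{u, u, u} f ⋙ ModuleCat.extendScalars g ≅ ModuleCat.extendScalars h :=
  (ModuleCat.extendScalarsComp f g).symm ≪≫ eqToIso (by rw [w])

/-- The base change functor `β` from finite dimensional `F`-vector spaces to patching problems. -/
def FactorizationInverseSystem.vectBaseChange (S : FactorizationInverseSystem F I) :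
    FGModuleCat.{u} F ⥤ VectPatchingProblem S where
  obj V :=
    { V := fun i => (extendFG (algebraMap F (S.K i))).obj V
      ν := fun {i j} h => (extendScalarsTrans (algebraMap F (S.K i)) (S.incl h).toRingHom
        (algebraMap F (S.K j)) (S.isInverseLimit.1 h)).app V.obj }
  map f :=
    { hom := fun i => (extendFG (algebraMap F (S.K i))).map f
      comm := fun {i j} h => (extendScalarsTrans (algebraMap F (S.K i)) (S.incl h).toRingHom
        (algebraMap F (S.K j)) (S.isInverseLimit.1 h)).hom.naturality f.hom }
  map_id V := VectPatchingProblem.Hom.ext (funext fun _ => (extendFG _).map_id V)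
  map_comp f g := VectPatchingProblem.Hom.ext (funext fun _ => (extendFG _).map_comp f g)

/-! ### Torsors -/

/-- `Spec K` as an `F`-scheme. -/
def specOver (F K : Type u) [Field F] [Field K] [Algebra F K] : Over (Spec (CommRingCat.of F)) :=
  Over.mk (Spec.map (CommRingCat.ofHom (algebraMap F K)))

/-- The morphism `Spec L ⟶ Spec K` of `F`-schemes given by an inclusion of fields `K → L`. -/
def specMap {K L : Type u} [Field K] [Field L] [Algebra F K] [Algebra F L] (f : K →ₐ[F] L) :
    specOver F L ⟶ specOver F K :=
  Over.homMk (Spec.map (CommRingCat.ofHom f.toRingHom)) (by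
    simp only [specOver, Over.mk_left, Over.mk_hom, ← Spec.map_comp, ← CommRingCat.ofHom_comp]
    congr 2
    exact f.comp_algebraMap)

/-- A (right) `G`-torsor over the extension field `K` of `F`, where `G` is a group scheme over `F`:
a non-empty `K`-scheme `X` with a right action of `G_K` such that `(x, g) ↦ (x, x g)` is an
isomorphism from `X ×_K G_K` to `X ×_K X`.  Since `X ×_K G_K = X ×_F G`, the action is
a morphism `X ×_F G ⟶ X`; the condition that `X ×_F G`, with the projection and
the action, is the fibre product of `X` with itself over `Spec K` includes that the action is
by `K`-morphisms. -/
structure Torsor (G : Over (Spec (CommRingCat.of F))) [GrpObj G] (K : Type u) [Field K]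
    [Algebra F K] where
  X : Over (Spec (CommRingCat.of F))
  p : X ⟶ specOver F K
  act : X ⊗ G ⟶ X
  act_one : X ◁ MonObj.one ≫ act = (ρ_ X).hom
  act_mul : (α_ X G G).hom ≫ X ◁ MonObj.mul ≫ act = act ▷ G ≫ act
  isPullback : IsPullback (fst X G) act p p
  nonempty : Nonempty X.left

namespace Torsor

variable {G : Over (Spec (CommRingCat.of F))} [GrpObj G]
  {K L M : Type u} [Field K] [Field L] [Field M] [Algebra F K] [Algebra F L] [Algebra F M]

/-- A morphism of torsors: a `G`-equivariant morphism of `K`-schemes. -/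
@[ext]
structure Hom (T T' : Torsor G K) where
  hom : T.X ⟶ T'.X
  w : hom ≫ T'.p = T.p
  equivariant : T.act ≫ hom = hom ▷ G ≫ T'.act

instance : Category (Torsor G K) where
  Hom := Hom
  id T := ⟨𝟙 _, by simp, by simp⟩
  comp f g := ⟨f.hom ≫ g.hom, by rw [Category.assoc, g.w, f.w], by
    rw [← Category.assoc, f.equivariant, Category.assoc, g.equivariant, comp_whiskerRight,
      Category.assoc]⟩

@[ext]
lemma hom_ext {T T' : Torsor G K} {f g : T ⟶ T'} (h : f.hom = g.hom) : f = g := Hom.ext h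

@[simp] lemma id_hom (T : Torsor G K) : (𝟙 T : T ⟶ T).hom = 𝟙 T.X := rfl

@[simp] lemma comp_hom {T T' T'' : Torsor G K} (f : T ⟶ T') (g : T' ⟶ T'') :
    (f ≫ g).hom = f.hom ≫ g.hom := rfl

/-- The action of `G` on `X ×_K L`. -/
def baseChangeAct (T : Torsor G K) (f : K →ₐ[F] L) :
    pullback T.p (specMap f) ⊗ G ⟶ pullback T.p (specMap f) :=
  pullback.lift (pullback.fst _ _ ▷ G ≫ T.act) (fst _ _ ≫ pullback.snd _ _) (by
    rw [Category.assoc, ← T.isPullback.w, Category.assoc, ← pullback.condition]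
    simp)

lemma baseChangeAct_fst (T : Torsor G K) (f : K →ₐ[F] L) :
    T.baseChangeAct f ≫ pullback.fst _ _ = pullback.fst _ _ ▷ G ≫ T.act :=
  pullback.lift_fst _ _ _

lemma baseChangeAct_snd (T : Torsor G K) (f : K →ₐ[F] L) :
    T.baseChangeAct f ≫ pullback.snd _ _ = fst _ _ ≫ pullback.snd _ _ :=
  pullback.lift_snd _ _ _

/-- The base change `X ×_K L` of a torsor. -/
def baseChangeObj (f : K →ₐ[F] L) (T : Torsor G K) : Torsor G L where
  X := pullback T.p (specMap f)
  p := pullback.snd _ _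
  act := T.baseChangeAct f
  act_one := by
    apply pullback.hom_ext
    · rw [Category.assoc, baseChangeAct_fst, whisker_exchange_assoc, T.act_one]
      simp
    · rw [Category.assoc, baseChangeAct_snd, whiskerLeft_fst_assoc, rightUnitor_hom]
  act_mul := by
    apply pullback.hom_ext
    · simp only [Category.assoc]
      rw [baseChangeAct_fst, whisker_exchange_assoc, ← comp_whiskerRight_assoc, baseChangeAct_fst,
        comp_whiskerRight_assoc, ← T.act_mul]
      simp
    · simp only [Category.assoc]
      rw [baseChangeAct_snd]
      simp [baseChangeAct_snd]
  isPullback := by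
    have cond (s : PullbackCone (pullback.snd T.p (specMap f)) (pullback.snd T.p (specMap f))) :
        (s.fst ≫ pullback.fst _ _) ≫ T.p = (s.snd ≫ pullback.fst _ _) ≫ T.p := by
      rw [Category.assoc, Category.assoc, pullback.condition, ← Category.assoc, s.condition,
        Category.assoc]
    refine ⟨⟨(T.baseChangeAct_snd f).symm⟩, ⟨PullbackCone.IsLimit.mk _
      (fun s => lift s.fst (T.isPullback.lift (s.fst ≫ pullback.fst _ _) (s.snd ≫ pullback.fst _ _)
        (cond s) ≫ snd _ _)) ?_ ?_ ?_⟩⟩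
    · intro s
      exact lift_fst _ _
    · intro s
      apply pullback.hom_ext
      · rw [Category.assoc, baseChangeAct_fst, ← Category.assoc, lift_whiskerRight]
        refine Eq.trans (congrArg (· ≫ T.act) ?_) (T.isPullback.lift_snd _ _ (cond s))
        apply CartesianMonoidalCategory.hom_ext
        · rw [lift_fst, T.isPullback.lift_fst]
        · rw [lift_snd]
      · rw [Category.assoc, baseChangeAct_snd, lift_fst_assoc]
        exact s.condition
    · intro s m h₁ h₂
      apply CartesianMonoidalCategory.hom_ext
      · rw [lift_fst, h₁]
      · rw [lift_snd]
        have : m ≫ pullback.fst _ _ ▷ G = T.isPullback.lift (s.fst ≫ pullback.fst _ _)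
            (s.snd ≫ pullback.fst _ _) (cond s) := by
          apply T.isPullback.hom_ext
          · rw [T.isPullback.lift_fst, Category.assoc, whiskerRight_fst, ← Category.assoc, h₁]
          · rw [T.isPullback.lift_snd, Category.assoc, ← baseChangeAct_fst, ← Category.assoc, h₂]
        rw [← this, Category.assoc, whiskerRight_snd]
  nonempty := by
    have h := (IsPullback.of_hasPullback T.p (specMap f)).map (Over.forget _)
    have : Subsingleton (specOver F K).left :=
      inferInstanceAs (Subsingleton (PrimeSpectrum K))
    have : Nonempty (specOver F L).left :=
      inferInstanceAs (Nonempty (PrimeSpectrum L))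
    have : Surjective T.p.left := ⟨fun y => ⟨T.nonempty.some, Subsingleton.elim _ _⟩⟩
    have : Surjective ((Over.forget _).map (pullback.snd T.p (specMap f))) :=
      MorphismProperty.of_isPullback h this
    obtain ⟨x, -⟩ := this.surj (Classical.arbitrary (specOver F L).left)
    exact ⟨x⟩

/-- The morphism `X ×_K L ⟶ X' ×_K L` induced by a morphism of torsors. -/
def baseChangeHom (f : K →ₐ[F] L) {T T' : Torsor G K} (φ : T ⟶ T') :
    pullback T.p (specMap f) ⟶ pullback T'.p (specMap f) :=
  pullback.lift (pullback.fst _ _ ≫ φ.hom) (pullback.snd _ _)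
    (by rw [Category.assoc, φ.w, pullback.condition])

lemma baseChangeHom_fst (f : K →ₐ[F] L) {T T' : Torsor G K} (φ : T ⟶ T') :
    baseChangeHom f φ ≫ pullback.fst _ _ = pullback.fst _ _ ≫ φ.hom :=
  pullback.lift_fst _ _ _

lemma baseChangeHom_snd (f : K →ₐ[F] L) {T T' : Torsor G K} (φ : T ⟶ T') :
    baseChangeHom f φ ≫ pullback.snd _ _ = pullback.snd _ _ :=
  pullback.lift_snd _ _ _

lemma baseChangeHom_equivariant (f : K →ₐ[F] L) {T T' : Torsor G K} (φ : T ⟶ T') :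
    T.baseChangeAct f ≫ baseChangeHom f φ = baseChangeHom f φ ▷ G ≫ T'.baseChangeAct f := by
  apply pullback.hom_ext
  · rw [Category.assoc, Category.assoc, baseChangeHom_fst, baseChangeAct_fst, ← Category.assoc,
      baseChangeAct_fst, Category.assoc, φ.equivariant, ← comp_whiskerRight_assoc,
      ← comp_whiskerRight_assoc, baseChangeHom_fst]
  · rw [Category.assoc, Category.assoc, baseChangeHom_snd, baseChangeAct_snd, baseChangeAct_snd,
      whiskerRight_fst_assoc, baseChangeHom_snd]

/-- Base change of torsors along `K → L`. -/
def baseChange (f : K →ₐ[F] L) : Torsor G K ⥤ Torsor G L where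
  obj T := T.baseChangeObj f
  map φ := ⟨baseChangeHom f φ, baseChangeHom_snd f φ, baseChangeHom_equivariant f φ⟩
  map_id T := by
    apply hom_ext
    apply pullback.hom_ext
    · exact (baseChangeHom_fst f (𝟙 T)).trans ((Category.comp_id _).trans (Category.id_comp _).symm)
    · exact (baseChangeHom_snd f (𝟙 T)).trans (Category.id_comp _).symm
  map_comp {T T' T''} φ ψ := by
    apply hom_ext
    change baseChangeHom f (φ ≫ ψ) = baseChangeHom f φ ≫ baseChangeHom f ψ
    apply pullback.hom_ext
    · rw [Category.assoc, baseChangeHom_fst, baseChangeHom_fst, ← Category.assoc,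
        baseChangeHom_fst, comp_hom, Category.assoc]
    · rw [Category.assoc, baseChangeHom_snd, baseChangeHom_snd, baseChangeHom_snd]

/-- The projection `X ×_K L ⟶ X`. -/
def proj (f : K →ₐ[F] L) (T : Torsor G K) : ((baseChange f).obj T).X ⟶ T.X :=
  pullback.fst T.p (specMap f)

lemma isPullback_proj (f : K →ₐ[F] L) (T : Torsor G K) :
    IsPullback (T.proj f) ((baseChange f).obj T).p T.p (specMap f) :=
  IsPullback.of_hasPullback _ _

lemma proj_act (f : K →ₐ[F] L) (T : Torsor G K) :
    ((baseChange f).obj T).act ≫ T.proj f = T.proj f ▷ G ≫ T.act :=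
  T.baseChangeAct_fst f

lemma map_proj (f : K →ₐ[F] L) {T T' : Torsor G K} (φ : T ⟶ T') :
    ((baseChange f).map φ).hom ≫ T'.proj f = T.proj f ≫ φ.hom :=
  baseChangeHom_fst f φ

lemma specMap_comp (f : K →ₐ[F] L) (g : L →ₐ[F] M) :
    specMap (g.comp f) = specMap g ≫ specMap f := by
  apply Over.OverMorphism.ext
  exact Spec.map_comp (CommRingCat.ofHom f.toRingHom) (CommRingCat.ofHom g.toRingHom)

/-- An equivariant isomorphism of `K`-schemes is an isomorphism of torsors. -/
def isoMk {T T' : Torsor G K} (e : T.X ≅ T'.X) (w : e.hom ≫ T'.p = T.p)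
    (equivariant : T.act ≫ e.hom = e.hom ▷ G ≫ T'.act) : T ≅ T' where
  hom := ⟨e.hom, w, equivariant⟩
  inv := ⟨e.inv, by rw [← w, e.inv_hom_id_assoc], by
    rw [← cancel_mono e.hom, Category.assoc, e.inv_hom_id, Category.comp_id, Category.assoc,
      equivariant, ← comp_whiskerRight_assoc, e.inv_hom_id, id_whiskerRight, Category.id_comp]⟩
  hom_inv_id := hom_ext e.hom_inv_id
  inv_hom_id := hom_ext e.inv_hom_id

lemma isPullback_proj_proj (f : K →ₐ[F] L) (g : L →ₐ[F] M) (h : K →ₐ[F] M) (w : g.comp f = h)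
    (T : Torsor G K) :
    IsPullback (((baseChange f).obj T).proj g ≫ T.proj f)
      ((baseChange g).obj ((baseChange f).obj T)).p T.p (specMap h) := by
  rw [← w, specMap_comp]
  exact (isPullback_proj g _).paste_horiz (isPullback_proj f T)

/-- Transitivity of base change: the canonical isomorphism `(X ×_K L) ×_L M ≅ X ×_K M`. -/
def baseChangeTrans (f : K →ₐ[F] L) (g : L →ₐ[F] M) (h : K →ₐ[F] M) (w : g.comp f = h)
    (T : Torsor G K) : (baseChange g).obj ((baseChange f).obj T) ≅ (baseChange h).obj T :=
  isoMk ((isPullback_proj_proj f g h w T).isoIsPullback _ _ (isPullback_proj h T))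
    (IsPullback.isoIsPullback_hom_snd _ _ _ _) (by
      apply (isPullback_proj h T).hom_ext
      · simp only [Category.assoc]
        rw [proj_act, IsPullback.isoIsPullback_hom_fst, ← comp_whiskerRight_assoc,
          IsPullback.isoIsPullback_hom_fst, ← Category.assoc, proj_act, Category.assoc, proj_act,
          comp_whiskerRight_assoc]
      · simp only [Category.assoc]
        rw [← Torsor.isPullback _ |>.w, IsPullback.isoIsPullback_hom_snd,
          ← Torsor.isPullback _ |>.w, whiskerRight_fst_assoc, IsPullback.isoIsPullback_hom_snd])

lemma baseChangeTrans_proj (f : K →ₐ[F] L) (g : L →ₐ[F] M) (h : K →ₐ[F] M) (w : g.comp f = h)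
    (T : Torsor G K) : (baseChangeTrans f g h w T).hom.hom ≫ T.proj h =
      ((baseChange f).obj T).proj g ≫ T.proj f :=
  IsPullback.isoIsPullback_hom_fst _ _ _ _

lemma baseChangeTrans_naturality (f : K →ₐ[F] L) (g : L →ₐ[F] M) (h : K →ₐ[F] M)
    (w : g.comp f = h) {T T' : Torsor G K} (φ : T ⟶ T') :
    (baseChange g).map ((baseChange f).map φ) ≫ (baseChangeTrans f g h w T').hom =
      (baseChangeTrans f g h w T).hom ≫ (baseChange h).map φ := by
  apply hom_ext
  apply (isPullback_proj h T').hom_ext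
  · simp only [comp_hom, Category.assoc]
    rw [baseChangeTrans_proj, map_proj, ← Category.assoc, map_proj, Category.assoc, map_proj,
      ← Category.assoc, ← Category.assoc, baseChangeTrans_proj]
  · rw [Hom.w, Hom.w]

/-- The coordinate ring (ring of global functions) of a torsor. -/
abbrev coordinateRing (T : Torsor G K) : Type u := Γ(T.X.left, ⊤)

end Torsor

/-! ### Torsor patching problems -/

/-- A `G`-torsor patching problem: `G`-torsors `T i` over `K i` and isomorphisms
`T i ×_{K i} K j ≅ T j` of `G`-torsors over `K j` for `i > j`. -/
structure TorsorPatchingProblem (S : FactorizationInverseSystem F I)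
    (G : Over (Spec (CommRingCat.of F))) [GrpObj G] where
  T : ∀ i, Torsor G (S.K i)
  ν : ∀ {i j : I} (h : i > j), (Torsor.baseChange (S.incl h)).obj (T i) ≅ T j

namespace TorsorPatchingProblem

variable {S : FactorizationInverseSystem F I} {G : Over (Spec (CommRingCat.of F))} [GrpObj G]

/-- A morphism of patching problems: torsor morphisms over all the `K i`, compatible with
the `ν`. -/
@[ext]
structure Hom (P Q : TorsorPatchingProblem S G) where
  hom : ∀ i, P.T i ⟶ Q.T i
  comm : ∀ {i j : I} (h : i > j),
    (Torsor.baseChange (S.incl h)).map (hom i) ≫ (Q.ν h).hom = (P.ν h).hom ≫ hom j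

instance : Category (TorsorPatchingProblem S G) where
  Hom := Hom
  id P := ⟨fun _ => 𝟙 _, fun h => by simp⟩
  comp f g := ⟨fun i => f.hom i ≫ g.hom i, fun h => by
    rw [Functor.map_comp, Category.assoc, g.comm h, ← Category.assoc, f.comm h, Category.assoc]⟩

/-- The transition map from the coordinate ring of `T i` to that of `T j`, for `i > j`, induced by
`T j ≅ T i ×_{K i} K j ⟶ T i`. -/
def res (P : TorsorPatchingProblem S G) {i j : I} (h : i > j) :
    (P.T i).coordinateRing →+* (P.T j).coordinateRing :=
  ((P.ν h).inv.hom ≫ (P.T i).proj (S.incl h)).left.appTop.hom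

end TorsorPatchingProblem

/-- The base change functor from `G`-torsors over `F` to `G`-torsor patching problems. -/
def FactorizationInverseSystem.torsorBaseChange (S : FactorizationInverseSystem F I)
    (G : Over (Spec (CommRingCat.of F))) [GrpObj G] :
    Torsor G F ⥤ TorsorPatchingProblem S G where
  obj T :=
    { T := fun i => (Torsor.baseChange (Algebra.ofId F (S.K i))).obj T
      ν := fun h => Torsor.baseChangeTrans _ (S.incl h) _ (Subsingleton.elim _ _) T }
  map φ :=
    { hom := fun i => (Torsor.baseChange (Algebra.ofId F (S.K i))).map φ
      comm := fun h => Torsor.baseChangeTrans_naturality _ (S.incl h) _ (Subsingleton.elim _ _) φ }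
  map_id T := TorsorPatchingProblem.Hom.ext (funext fun _ => (Torsor.baseChange _).map_id T)
  map_comp φ ψ :=
    TorsorPatchingProblem.Hom.ext (funext fun _ => (Torsor.baseChange _).map_comp φ ψ)

/-- For a solution `T` of a patching problem `P`, given with an isomorphism `e` from the patching
problem induced by `T` to `P`: the map from the coordinate ring of `T` to that of `P.T i` induced
by `P.T i ≅ T ×_F K i ⟶ T`. -/
def solutionRes {S : FactorizationInverseSystem F I} {G : Over (Spec (CommRingCat.of F))}
    [GrpObj G] {P : TorsorPatchingProblem S G} {T : Torsor G F}
    (e : (S.torsorBaseChange G).obj T ≅ P) (i : I) :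
    T.coordinateRing →+* (P.T i).coordinateRing :=
  ((e.inv.hom i).hom ≫ T.proj (Algebra.ofId F (S.K i))).left.appTop.hom

end TorsorPatching

end

/-! Torsors under an affine group are affine, so the statement is one about coordinate rings, which
are usually infinite dimensional, whereas `β` speaks of finite dimensional spaces only.

Full faithfulness uses only that `F` is the limit of the `K i`. Comparing coordinates in a basis
shows that any `F`-vector space, of whatever dimension, is the limit of its extensions to the `K i`
(`existsUnique_of_compatible`). Hence compatible morphisms between base changes of affine schemes
glue (`exists_hom_of_compatible`), and identities over `F` can be tested after one extension `K i`,
because the projections are epimorphisms.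

Essential surjectivity requires `B ⊗ K i ≅ A i`, where `A i` is the coordinate ring of `T i` and `B`
is the limit of the `A i`. Fix a basis of `H = F[G]`. For a finite set `s` of basis vectors, let `N
s i` be the space of `a` in `A i` whose image under the coaction `A i → A i ⊗ H` involves only `s`.
These spaces exhaust `A i` and commute with extension of scalars (`span_coactionFiltration`). They
are finite dimensional because of the torsor condition: since `A i ⊗ A i ≅ A i ⊗ H`, the coaction
sends vectors independent over `K i` to vectors independent over `A i`, and a free module of rank
`|s|` has room for at most `|s|` of these (`finite_coactionFiltration`). So each layer descends to
`F` by essential surjectivity of `β`, and the union of the layers yields the claim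
(`isScalarExtension_limit`, `isPushout_limit`). Then `Spec B` receives a glued action, which is
simply transitive by faithfully flat descent. -/

namespace TorsorPatching

/-! ### Extension of scalars -/

section ScalarExtension

variable {K L A A' : Type*} [Field K] [Field L] [AddCommGroup A] [Module K A] [AddCommGroup A']
  [Module L A'] {σ : K →+* L}

/-- A semilinear map `A → A'` along a homomorphism of fields `K → L` exhibits `A'` as
the extension of scalars of `A`. -/
structure IsScalarExtension (r : A →ₛₗ[σ] A') : Prop where
  linearIndepOn : ∀ s : Set A, LinearIndepOn K id s → LinearIndepOn L r s
  span_eq_top : Submodule.span L (Set.range r) = ⊤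

namespace IsScalarExtension

variable {r : A →ₛₗ[σ] A'}

/-- An independent family is injective, so it may be replaced by its range. The definition
quantifies over subsets of `A` so that no universe of index types enters it. -/
lemma linearIndependent (hr : IsScalarExtension r) {ι : Type*} {v : ι → A}
    (hv : LinearIndependent K v) : LinearIndependent L (r ∘ v) :=
  (hr.linearIndepOn _ hv.linearIndepOn_id).linearIndependent.comp
    (fun i => (⟨v i, i, rfl⟩ : Set.range v)) fun _ _ h => hv.injective (congrArg Subtype.val h)

lemma span_range_basis (hr : IsScalarExtension r) {ι : Type*} (b : Module.Basis ι K A) :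
    ⊤ ≤ Submodule.span L (Set.range (r ∘ b)) := by
  rw [← hr.span_eq_top, Submodule.span_le]
  rintro _ ⟨a, rfl⟩
  rw [← b.linearCombination_repr a, Finsupp.linearCombination_apply, Finsupp.sum, map_sum]
  refine Submodule.sum_mem _ fun i _ => ?_
  rw [map_smulₛₗ]
  exact Submodule.smul_mem _ _ (Submodule.subset_span ⟨i, rfl⟩)

/-- The basis of `A'` obtained from a basis of `A`. -/
noncomputable def basis (hr : IsScalarExtension r) {ι : Type*} (b : Module.Basis ι K A) :
    Module.Basis ι L A' :=
  Module.Basis.mk (hr.linearIndependent b.linearIndependent) (hr.span_range_basis b)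

@[simp]
lemma basis_apply (hr : IsScalarExtension r) {ι : Type*} (b : Module.Basis ι K A) (i : ι) :
    hr.basis b i = r (b i) := by
  simp [basis]

/-- In the bases `b` and `r ∘ b`, the map `r` is `σ` applied to each coordinate. Most arguments
about extension of scalars below reduce to this. -/
lemma basis_repr (hr : IsScalarExtension r) {ι : Type*} (b : Module.Basis ι K A) (a : A) (i : ι) :
    (hr.basis b).repr (r a) i = σ (b.repr a i) := by
  have : r a = Finsupp.linearCombination L (hr.basis b)
      ((b.repr a).mapRange σ (map_zero σ)) := by
    conv_lhs => rw [← b.linearCombination_repr a]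
    rw [Finsupp.linearCombination_apply, Finsupp.linearCombination_apply,
      Finsupp.sum_mapRange_index (by simp), Finsupp.sum, map_sum, Finsupp.sum]
    exact Finset.sum_congr rfl fun i _ => by rw [map_smulₛₗ, basis_apply]
  rw [this, Module.Basis.repr_linearCombination, Finsupp.mapRange_apply]

lemma injective (hr : IsScalarExtension r) : Function.Injective r := by
  intro a a' h
  let b := Module.Basis.ofVectorSpace K A
  apply b.repr.injective
  ext i
  apply σ.injective
  rw [← hr.basis_repr, ← hr.basis_repr, h]

/-- If the `l k` are linearly independent over `K`, then `∑ l k • r (a k)` vanishes only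
if all the `a k` do. -/
lemma eq_zero_of_sum_smul_eq_zero (hr : IsScalarExtension r) {ι : Type*} (s : Finset ι)
    (l : ι → L) (hl : ∀ g : ι → K, ∑ k ∈ s, σ (g k) * l k = 0 → ∀ k ∈ s, g k = 0) (a : ι → A)
    (h : ∑ k ∈ s, l k • r (a k) = 0) : ∀ k ∈ s, a k = 0 := by
  let b := Module.Basis.ofVectorSpace K A
  have key (m) : ∀ k ∈ s, b.repr (a k) m = 0 := by
    apply hl
    have := congrArg (fun x => (hr.basis b).repr x m) h
    simpa [Finsupp.finsetSum_apply, basis_repr, mul_comm] using this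
  intro k hk
  apply b.repr.injective
  ext m
  simpa using key m k hk

lemma of_isBaseChange [Algebra K L] [Module K A'] [IsScalarTower K L A'] {r' : A →ₗ[K] A'}
    (h : IsBaseChange L r') (hr : ∀ a, r a = r' a) : IsScalarExtension r := by
  refine ⟨fun s hs => ?_, ?_⟩
  · have := (h.basis (Module.Basis.extend hs)).linearIndependent.comp
      (fun x : s => (⟨x, hs.subset_extend _ x.2⟩ : hs.extend (Set.subset_univ _)))
      fun x y hxy => Subtype.ext (by simpa using hxy)
    have e : (h.basis (Module.Basis.extend hs) ∘ fun x : s =>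
        (⟨x, hs.subset_extend _ x.2⟩ : hs.extend (Set.subset_univ _))) = fun x : s => r x :=
      funext fun x => by
        simp only [Function.comp_apply, IsBaseChange.basis_apply, Module.Basis.extend_apply_self,
          hr]
    rwa [e] at this
  · refine top_le_iff.1 fun x _ => ?_
    induction x using h.inductionOn with
    | zero => exact zero_mem _
    | tmul a => exact Submodule.subset_span ⟨a, hr a⟩
    | smul l x hx => exact Submodule.smul_mem _ _ (hx trivial)
    | add x y hx hy => exact add_mem (hx trivial) (hy trivial)

lemma isBaseChange [Algebra K L] [Module K A'] [IsScalarTower K L A']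
    (h : IsScalarExtension r) (r' : A →ₗ[K] A') (hr : ∀ a, r a = r' a) : IsBaseChange L r' := by
  let b := Module.Basis.ofVectorSpace K A
  refine IsBaseChange.of_equiv ((b.baseChange L).equiv (h.basis b) (Equiv.refl _)) fun x => ?_
  have : (((b.baseChange L).equiv (h.basis b) (Equiv.refl _)).toLinearMap.restrictScalars K).comp
      (TensorProduct.mk K L A 1) = r' := by
    refine b.ext fun i => ?_
    simp only [LinearMap.comp_apply, LinearMap.restrictScalars_apply, TensorProduct.mk_apply,
      LinearEquiv.coe_coe]
    rw [← Module.Basis.baseChange_apply, Module.Basis.equiv_apply, Equiv.refl_apply, basis_apply,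
      hr]
  exact LinearMap.congr_fun this x

end IsScalarExtension

end ScalarExtension
end TorsorPatching

namespace TorsorPatching

/-! ### Comparison with the functor `ModuleCat.extendScalars` -/

section ExtendScalars

variable {K L : Type u} [Field K] [Field L] (σ : K →+* L)

open ModuleCat ChangeOfRings

/-- The canonical map from a vector space to its extension of scalars. -/
noncomputable def toExtendScalars (M : ModuleCat.{u} K) : M →ₛₗ[σ] (extendScalars σ).obj M where
  toFun m := (1 : L) ⊗ₜ[K,σ] m
  map_add' x y := TensorProduct.tmul_add _ _ _
  map_smul' c x := by
    let := σ.toAlgebra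
    have h1 : (1 : L) ⊗ₜ[K] (c • x) = (c • (1 : L)) ⊗ₜ[K] x :=
      (TensorProduct.smul_tmul c (1 : L) x).symm
    have h2 : (c • (1 : L)) ⊗ₜ[K] x = (σ c * (1 : L)) ⊗ₜ[K] x := by
      rw [Algebra.smul_def]; rfl
    exact h1.trans h2

lemma isScalarExtension_toExtendScalars (M : ModuleCat.{u} K) :
    IsScalarExtension (toExtendScalars σ M) := by
  let := σ.toAlgebra
  have h := TensorProduct.isBaseChange K M L
  let r : M →ₛₗ[σ] TensorProduct K L M :=
    { toFun := fun m => (1 : L) ⊗ₜ[K] m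
      map_add' := fun x y => TensorProduct.tmul_add _ _ _
      map_smul' := fun c x => by
        rw [← TensorProduct.smul_tmul, Algebra.smul_def, TensorProduct.smul_tmul']; rfl }
  exact IsScalarExtension.of_isBaseChange (r := r) h fun _ => rfl

/-- A basis of `M` induces bases on both sides. Matching them gives an isomorphism, and it respects
the maps from `M` because both of these are `σ` in coordinates. -/
lemma exists_iso_extendScalars {M : ModuleCat.{u} K} {M' : ModuleCat.{u} L} (r : M →ₛₗ[σ] M')
    (hr : IsScalarExtension r) :
    ∃ e : (extendScalars σ).obj M ≅ M', ∀ m, e.hom (toExtendScalars σ M m) = r m := by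
  let b := Module.Basis.ofVectorSpace K M
  let e := ((isScalarExtension_toExtendScalars σ M).basis b).equiv (hr.basis b) (Equiv.refl _)
  refine ⟨e.toModuleIso, fun m => ?_⟩
  change e (toExtendScalars σ M m) = r m
  apply (hr.basis b).repr.injective
  ext i
  rw [hr.basis_repr]
  rw [← (isScalarExtension_toExtendScalars σ M).basis_repr b m i]
  simp [e, Module.Basis.equiv]

lemma extendScalarsTrans_toExtendScalars {M : Type u} [Field M] (g : L →+* M) (h : K →+* M)
    (w : g.comp σ = h) (V : ModuleCat.{u} K) (v : V) :
    (extendScalarsTrans σ g h w).hom.app V (toExtendScalars g _ (toExtendScalars σ V v)) =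
      toExtendScalars h V v := by
  -- Once `h` is literally `g.comp σ`, the `eqToIso` in `extendScalarsTrans` is an identity.
  subst w
  have := extendScalarsComp_hom_app_one_tmul σ g V v
  rw [extendScalarsTrans]
  simp only [eqToIso_refl, Iso.trans_refl, Iso.symm_hom]
  have h2 : toExtendScalars g _ (toExtendScalars σ V v) =
    (extendScalarsComp σ g).hom.app V (toExtendScalars (g.comp σ) V v) := this.symm
  rw [h2]
  exact ConcreteCategory.congr_hom ((extendScalarsComp σ g).hom_inv_id_app V) _

end ExtendScalars

/-! ### Patching of vector spaces, finite dimensional and filtered -/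

section Patching

variable {F : Type u} [Field F] {I : Type} [Finite I] [PartialOrder I]

/-- An empty system has the zero ring as its limit, and this is not a field. -/
lemma FactorizationInverseSystem.nonempty_index (S : FactorizationInverseSystem F I) :
    Nonempty I := by
  by_contra hI
  rw [not_nonempty_iff] at hI
  obtain ⟨b, -, hb⟩ := S.isInverseLimit.2 (fun i => isEmptyElim i) (fun {i} => isEmptyElim i)
  exact zero_ne_one ((hb 0 fun i => isEmptyElim i).trans (hb 1 fun i => isEmptyElim i).symm)

variable (S : FactorizationInverseSystem F I)

section Limit

variable {V : Type*} [AddCommGroup V] [Module F V] {W : I → Type*} [∀ i, AddCommGroup (W i)]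
  [∀ i, Module (S.K i) (W i)] (π : ∀ i, V →ₛₗ[algebraMap F (S.K i)] W i)

/-- A vector space over `F` is the inverse limit of its extensions of scalars. -/
lemma FactorizationInverseSystem.existsUnique_of_compatible
    (hπ : ∀ i, IsScalarExtension (π i))
    (res : ∀ {i j : I} (h : i > j), W i →ₛₗ[(S.incl h).toRingHom] W j)
    (hres : ∀ {i j : I} (h : i > j) (v : V), res h (π i v) = π j v)
    (w : ∀ i, W i) (hw : ∀ {i j : I} (h : i > j), res h (w i) = w j) :
    ∃! v, ∀ i, π i v = w i := by
  obtain ⟨i₀⟩ := S.nonempty_index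
  let b := Module.Basis.ofVectorSpace F V
  let c (i : I) := ((hπ i).basis b).repr (w i)
  have hc {i j : I} (h : i > j) (m) : S.incl h (c i m) = c j m := by
    have h1 : w j = Finsupp.linearCombination (S.K j) ((hπ j).basis b)
        ((c i).mapRange (S.incl h) (map_zero _)) := by
      rw [← hw h]
      conv_lhs => rw [← ((hπ i).basis b).linearCombination_repr (w i)]
      rw [Finsupp.linearCombination_apply, Finsupp.linearCombination_apply,
        Finsupp.sum_mapRange_index (by simp), Finsupp.sum, map_sum, Finsupp.sum]
      refine Finset.sum_congr rfl fun m _ => ?_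
      rw [map_smulₛₗ, IsScalarExtension.basis_apply, IsScalarExtension.basis_apply, hres h]
      rfl
    change _ = ((hπ j).basis b).repr (w j) m
    rw [h1, Module.Basis.repr_linearCombination, Finsupp.mapRange_apply]
  -- For fixed `m` the coordinates of the `w i` form a compatible family in the `K i`, hence an
  -- element of `F`.
  choose d hd _ using fun m => S.isInverseLimit.2 (fun i => c i m) (fun h => hc h m)
  -- Field homomorphisms are injective, so `d` vanishes wherever the coordinates of the single
  -- vector `w i₀` do.
  have hfin : (Function.support d).Finite := by
    refine (c i₀).hasFiniteSupport.subset fun m hm => ?_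
    rw [Function.mem_support, ← hd m i₀]
    exact (map_ne_zero _).2 hm
  refine ⟨b.repr.symm (Finsupp.ofSupportFinite d hfin), fun i => ?_, fun v hv => ?_⟩
  · apply ((hπ i).basis b).repr.injective
    ext m
    rw [IsScalarExtension.basis_repr, LinearEquiv.apply_symm_apply]
    exact hd m i
  · apply (hπ i₀).injective
    rw [hv]
    apply ((hπ i₀).basis b).repr.injective
    ext m
    rw [IsScalarExtension.basis_repr, LinearEquiv.apply_symm_apply]
    exact (hd m i₀).symm

end Limit

/-- If `β` is essentially surjective, then a compatible system of finite dimensional vector spaces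
over the `K i` comes from a vector space over `F`. -/
lemma FactorizationInverseSystem.exists_descent (hβ : S.vectBaseChange.EssSurj)
    {N : I → Type u} [∀ i, AddCommGroup (N i)] [∀ i, Module (S.K i) (N i)]
    [∀ i, Module.Finite (S.K i) (N i)]
    (res : ∀ {i j : I} (h : i > j), N i →ₛₗ[(S.incl h).toRingHom] N j)
    (hres : ∀ {i j : I} (h : i > j), IsScalarExtension (res h)) :
    ∃ (V : ModuleCat.{u} F) (π : ∀ i, V →ₛₗ[algebraMap F (S.K i)] N i),
      (∀ i, IsScalarExtension (π i)) ∧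
      ∀ {i j : I} (h : i > j) (v : V), res h (π i v) = π j v := by
  choose ν hν using fun {i j : I} (h : i > j) => exists_iso_extendScalars (S.incl h).toRingHom
    (M := ModuleCat.of (S.K i) (N i)) (M' := ModuleCat.of (S.K j) (N j)) (res h) (hres h)
  let P : VectPatchingProblem S := ⟨fun i => FGModuleCat.of (S.K i) (N i), fun h => ν h⟩
  obtain ⟨V, ⟨e⟩⟩ := hβ.mem_essImage P
  let ε (i : I) : (ModuleCat.extendScalars (algebraMap F (S.K i))).obj V.obj →ₗ[S.K i] N i :=
    (e.hom.hom i).hom.hom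
  have hε (i : I) : Function.Bijective (ε i) := by
    have h1 : e.hom.hom i ≫ e.inv.hom i = 𝟙 _ :=
      congrArg (fun f : VectPatchingProblem.Hom _ _ => f.hom i) e.hom_inv_id
    have h2 : e.inv.hom i ≫ e.hom.hom i = 𝟙 _ :=
      congrArg (fun f : VectPatchingProblem.Hom _ _ => f.hom i) e.inv_hom_id
    refine ⟨Function.LeftInverse.injective (g := (e.inv.hom i).hom.hom) fun x => ?_,
      Function.RightInverse.surjective (g := (e.inv.hom i).hom.hom) fun x => ?_⟩
    · exact ConcreteCategory.congr_hom h1 x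
    · exact ConcreteCategory.congr_hom h2 x
  refine ⟨V.obj, fun i => (ε i).comp (toExtendScalars (algebraMap F (S.K i)) V.obj),
    fun i => ?_, fun {i j} h v => ?_⟩
  · have h := isScalarExtension_toExtendScalars (algebraMap F (S.K i)) V.obj
    refine ⟨fun s hs => ?_, ?_⟩
    · exact (h.linearIndepOn s hs).map_injOn (ε i) (hε i).1.injOn
    · have := congrArg (Submodule.map (ε i)) h.span_eq_top
      rw [Submodule.map_top, LinearMap.range_eq_top.2 (hε i).2, Submodule.map_span,
        ← Set.range_comp] at this
      exact this
  -- Compatibility of `e` with the `ν`, evaluated at `1 ⊗ (1 ⊗ v)`; `h2` and `h1` identify the two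
  -- sides.
  · have hc := ConcreteCategory.congr_hom (e.hom.comm h)
      (toExtendScalars (S.incl h).toRingHom _ (toExtendScalars (algebraMap F (S.K i)) V.obj v))
    have h1 := extendScalarsTrans_toExtendScalars (algebraMap F (S.K i)) (S.incl h).toRingHom
      (algebraMap F (S.K j)) (S.isInverseLimit.1 h) V.obj v
    have h2 := hν h (ε i (toExtendScalars (algebraMap F (S.K i)) V.obj v))
    refine h2.symm.trans (hc.trans ?_)
    exact congrArg (ε j) h1

/-- If `β` is essentially surjective, then patching works for a compatible system of vector spaces
that is a directed union of compatible systems of finite dimensional subspaces. -/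
theorem FactorizationInverseSystem.isScalarExtension_limit (hβ : S.vectBaseChange.EssSurj)
    {A : I → Type u} [∀ i, AddCommGroup (A i)] [∀ i, Module (S.K i) (A i)]
    (res : ∀ {i j : I} (h : i > j), A i →ₛₗ[(S.incl h).toRingHom] A j)
    (hres : ∀ {i j : I} (h : i > j), IsScalarExtension (res h))
    {κ : Type*} (N : Finset κ → ∀ i, Submodule (S.K i) (A i)) (hmono : ∀ i, Monotone (N · i))
    (hfin : ∀ s i, Module.Finite (S.K i) (N s i)) (hexh : ∀ i a, ∃ s, a ∈ N s i)
    (hN : ∀ s {i j : I} (h : i > j),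
      Submodule.span (S.K j) (res h '' (N s i)) = N s j)
    {B : Type*} [AddCommGroup B] [Module F B] (π : ∀ i, B →ₛₗ[algebraMap F (S.K i)] A i)
    (hπ : ∀ {i j : I} (h : i > j) (b : B), res h (π i b) = π j b)
    (hlim : ∀ a : ∀ i, A i, (∀ {i j : I} (h : i > j), res h (a i) = a j) →
      ∃! b : B, ∀ i, π i b = a i) (i : I) :
    IsScalarExtension (π i) := by
  classical
  have hmem (s) {i j : I} (h : i > j) (a : A i) (ha : a ∈ N s i) : res h a ∈ N s j := by
    rw [← hN s h]
    exact Submodule.subset_span ⟨a, ha, rfl⟩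
  let res' (s) {i j : I} (h : i > j) : N s i →ₛₗ[(S.incl h).toRingHom] N s j :=
    { toFun := fun a => ⟨res h a, hmem s h a a.2⟩
      map_add' := fun a b => Subtype.ext (map_add _ _ _)
      map_smul' := fun c a => Subtype.ext (map_smulₛₗ _ _ _) }
  have hres' (s) {i j : I} (h : i > j) : IsScalarExtension (res' s h) := by
    refine ⟨fun t ht => ?_, ?_⟩
    · have h1 : LinearIndependent (S.K i) (fun x : t => ((x : N s i) : A i)) :=
        ht.linearIndependent.map' (N s i).subtype (Submodule.ker_subtype _)
      exact LinearIndependent.of_comp (N s j).subtype ((hres h).linearIndependent h1)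
    · apply Submodule.map_injective_of_injective (N s j).injective_subtype
      rw [Submodule.map_span, Submodule.map_top, Submodule.range_subtype]
      refine Eq.trans (congrArg _ ?_) (hN s h)
      rw [← Set.range_comp]
      ext x
      exact ⟨fun ⟨a, ha⟩ => ⟨a, a.2, ha⟩, fun ⟨a, ha, hx⟩ => ⟨⟨a, ha⟩, hx⟩⟩
  -- Each layer `N s` is a finite dimensional patching problem, so it descends to some `V s` over
  -- `F`.
  choose V p hp hpc using fun s => S.exists_descent hβ (res' s) (hres' s)
  have lift (s) (v : V s) : ∃ b : B, ∀ i, π i b = p s i v := by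
    refine (hlim (fun i => p s i v) fun h => ?_).exists
    exact congrArg Subtype.val (hpc s h v)
  refine ⟨fun t ht => ?_, top_le_iff.1 fun a _ => ?_⟩
  · rw [linearIndepOn_iff_linearIndepOn_finset]
    intro u hu
    replace ht : LinearIndependent F (fun x : u => (x : B)) := ht.mono hu
    cases nonempty_fintype I
    choose f hf using fun (b : B) (i : I) => hexh i (π i b)
    -- As `u` and `I` are finite, one layer contains every `π i b`. The `b` in `u` then correspond
    -- to vectors of `V s`.
    let s : Finset κ := u.biUnion fun b => Finset.univ.biUnion (f b)
    have hs (b : u) (i : I) : π i b ∈ N s i := by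
      refine hmono i ?_ (hf b i)
      exact (Finset.subset_biUnion_of_mem (f b) (Finset.mem_univ i)).trans
        (Finset.subset_biUnion_of_mem (fun b => Finset.univ.biUnion (f b)) b.2)
    choose v hv _ using fun b : u => S.existsUnique_of_compatible (p s) (hp s) (res' s) (hpc s)
      (fun i => ⟨π i b, hs b i⟩) (fun h => Subtype.ext (hπ h b))
    -- A relation among the `v b` gives one among the `π i b` for every `i`, hence one among the
    -- `b`, since an element of `B` killed by all `π i` is zero.
    have hvi : LinearIndependent F v := by
      rw [Fintype.linearIndependent_iff] at ht ⊢
      intro g hg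
      apply ht g
      refine (hlim (fun _ => 0) fun h => map_zero _).unique (fun i => ?_) fun i => map_zero _
      have h1 := congrArg (fun x => (p s i x : A i)) hg
      simpa [map_smulₛₗ, hv] using h1
    have h1 := ((hp s i).linearIndependent hvi).map' (N s i).subtype (Submodule.ker_subtype _)
    refine (congrArg (fun w : u → A i => LinearIndependent (S.K i) w) (funext fun b => ?_)).mp h1
    simp [hv]
  -- A layer containing `a` is spanned by the image of `V s`, and this image lies in that of `B` by
  -- the limit property.
  · obtain ⟨s, hs⟩ := hexh i a
    have h1 : (⟨a, hs⟩ : N s i) ∈ Submodule.span (S.K i) (Set.range (p s i)) :=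
      (hp s i).span_eq_top ▸ Submodule.mem_top
    have h2 := Submodule.mem_map_of_mem (f := (N s i).subtype) h1
    rw [Submodule.map_span, ← Set.range_comp] at h2
    refine Submodule.span_mono ?_ h2
    rintro _ ⟨v, rfl⟩
    obtain ⟨b, hb⟩ := lift s v
    exact ⟨b, hb i⟩

end Patching
end TorsorPatching

namespace TorsorPatching

/-! ### Extension of scalars for algebras -/

section RingHom

variable {K L A A' : Type*} [Field K] [Field L] [CommRing A] [CommRing A'] [Algebra K A]
  [Algebra L A'] (σ : K →+* L) (r : A →+* A')

/-- A ring homomorphism `A → A'` lying over a homomorphism of fields `K → L`, as a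
semilinear map. -/
def semilinearMap (hr : r.comp (algebraMap K A) = (algebraMap L A').comp σ) : A →ₛₗ[σ] A' where
  toFun := r
  map_add' := map_add r
  map_smul' c a := by
    rw [Algebra.smul_def, Algebra.smul_def, map_mul]
    exact congrArg (· * r a) (RingHom.congr_fun hr c)

/-- The dictionary between linear algebra, where bases and filtrations are available, and pushouts
of rings, which correspond to fibre products of affine schemes. -/
lemma isScalarExtension_iff_isPushout {K L A A' : Type u} [Field K] [Field L] [CommRing A]
    [CommRing A'] [Algebra K A] [Algebra L A'] (σ : K →+* L) (r : A →+* A')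
    (hr : r.comp (algebraMap K A) = (algebraMap L A').comp σ) :
    IsScalarExtension (semilinearMap σ r hr) ↔
      IsPushout (CommRingCat.ofHom σ) (CommRingCat.ofHom (algebraMap K A))
        (CommRingCat.ofHom (algebraMap L A')) (CommRingCat.ofHom r) := by
  let := σ.toAlgebra
  let := r.toAlgebra
  let := ((algebraMap L A').comp σ).toAlgebra
  have : IsScalarTower K L A' := .of_algebraMap_eq fun _ => rfl
  have : IsScalarTower K A A' := .of_algebraMap_eq fun x => (RingHom.congr_fun hr x).symm
  refine Iff.trans ?_ (CommRingCat.isPushout_iff_isPushout (R := K) (S := A) (R' := L)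
    (S' := A')).symm
  rw [Algebra.isPushout_iff]
  exact ⟨fun h => h.isBaseChange _ fun _ => rfl, fun h => .of_isBaseChange h fun _ => rfl⟩

end RingHom

/-! ### The filtration of a comodule algebra -/

section Filtration

variable {K A C κ : Type*} [Field K] [CommRing A] [Algebra K A] [CommRing C] [Algebra A C]
  (b : Module.Basis κ A C) (act : A →+* C)
  (hact : ∀ k : K, act (algebraMap K A k) = algebraMap A C (algebraMap K A k))

/-- Given `act : A → C`, where `C` has a basis `b` over `A`, this is the subspace of the elements
of `A` whose image under `act` is in the span of the `b m` with `m ∈ s`. -/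
def coactionFiltration (s : Finset κ) : Submodule K A where
  carrier := {a | ∀ m ∉ s, b.repr (act a) m = 0}
  add_mem' {x y} hx hy m hm := by simp [hx m hm, hy m hm]
  zero_mem' m hm := by simp
  smul_mem' k x hx m hm := by
    rw [Algebra.smul_def, map_mul, hact, ← Algebra.smul_def, map_smul, Finsupp.smul_apply,
      hx m hm, smul_zero]

lemma coactionFiltration_mono : Monotone (coactionFiltration b act hact) :=
  fun _ _ h _ ha m hm => ha m fun h' => hm (h h')

lemma exists_mem_coactionFiltration (a : A) : ∃ s, a ∈ coactionFiltration b act hact s :=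
  ⟨(b.repr (act a)).support, fun _ hm => Finsupp.notMem_support_iff.1 hm⟩

/-- By `hinj`, vectors of the layer independent over `K` have images under `act` independent over
`A`. These images lie in a free `A`-module of rank `s.card`, which bounds their number. -/
lemma finite_coactionFiltration [Nontrivial A]
    (hinj : ∀ {n : ℕ} (v : Fin n → A), LinearIndependent K v → LinearIndependent A (act ∘ v))
    (s : Finset κ) : Module.Finite K (coactionFiltration b act hact s) := by
  have : Module.rank K (coactionFiltration b act hact s) ≤ s.card := by
    refine rank_le fun u hu => ?_
    let v : Fin u.card → coactionFiltration b act hact s := fun k => u.equivFin.symm k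
    have h1 : LinearIndependent K v := hu.comp _ u.equivFin.symm.injective
    have h3 := hinj _ (h1.map' (Submodule.subtype _) (Submodule.ker_subtype _))
    -- Coordinates outside `s` vanish, so a relation between the coordinates in `s` is already one
    -- between the vectors `act (v k)`.
    have h4 : LinearIndependent A fun k (m : s) => b.repr (act (v k)) m := by
      rw [Fintype.linearIndependent_iff] at h3 ⊢
      intro g hg
      apply h3 g
      apply b.repr.injective
      ext m
      by_cases hm : m ∈ s
      · have := congrFun hg ⟨m, hm⟩
        simpa [Finsupp.finsetSum_apply] using this
      · simp only [map_sum, map_smul, Finsupp.finsetSum_apply, Finsupp.smul_apply, map_zero,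
          Finsupp.coe_zero, Pi.zero_apply]
        refine Finset.sum_eq_zero fun x _ => ?_
        have h5 : b.repr (act (v x : A)) m = 0 := (v x).2 m hm
        exact (congrArg (g x • ·) h5).trans (smul_zero _)
    simpa using h4.fintype_card_le_finrank
  exact Module.rank_lt_aleph0_iff.1 (this.trans_lt (Cardinal.natCast_lt_aleph0))

end Filtration

/-! ### Compatibility of the filtration with field extension -/

section FiltrationBaseChange

variable {K L A A' C C' κ : Type*} [Field K] [Field L] [CommRing A] [CommRing A'] [CommRing C]
  [CommRing C'] [Algebra K A] [Algebra L A'] [Algebra A C] [Algebra A' C'] {σ : K →+* L}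
  (b : Module.Basis κ A C) (act : A →+* C)
  (hact : ∀ k : K, act (algebraMap K A k) = algebraMap A C (algebraMap K A k))
  (b' : Module.Basis κ A' C') (act' : A' →+* C')
  (hact' : ∀ k : L, act' (algebraMap L A' k) = algebraMap A' C' (algebraMap L A' k))
  (t : C →+* C')

/-- The analogue of `IsScalarExtension.basis_repr` over rings: `t` acts on coordinates through `r`.
-/
lemma repr_act_eq (r : A →+* A') (ht : ∀ a, t (algebraMap A C a) = algebraMap A' C' (r a))
    (hb : ∀ m, t (b m) = b' m) (c : C) (m : κ) :
    b'.repr (t c) m = r (b.repr c m) := by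
  have : t c = Finsupp.linearCombination A' b' ((b.repr c).mapRange r (map_zero r)) := by
    conv_lhs => rw [← b.linearCombination_repr c]
    rw [Finsupp.linearCombination_apply, Finsupp.linearCombination_apply,
      Finsupp.sum_mapRange_index (by simp), Finsupp.sum, map_sum, Finsupp.sum]
    refine Finset.sum_congr rfl fun m _ => ?_
    rw [Algebra.smul_def, Algebra.smul_def, map_mul, ht, hb]
  rw [this, Module.Basis.repr_linearCombination, Finsupp.mapRange_apply]

/-- Elements of `A' = L ⊗ A` are expanded along a `K`-basis of `L`. The condition on `u` is linear
independence over `K`, in the form that `eq_zero_of_sum_smul_eq_zero` takes. -/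
lemma IsScalarExtension.exists_eq_sum {A A' : Type*} [AddCommGroup A] [Module K A] [AddCommGroup A']
    [Module L A'] {r : A →ₛₗ[σ] A'} (hr : IsScalarExtension r) (x : A') :
    ∃ (u : Finset L) (a : L → A), (∀ g : L → K, ∑ k ∈ u, σ (g k) * k = 0 → ∀ k ∈ u, g k = 0) ∧
      x = ∑ k ∈ u, k • r (a k) := by
  classical
  let := σ.toAlgebra
  let := Module.compHom A' σ
  have : IsScalarTower K L A' := ⟨fun x y z => by
    rw [Algebra.smul_def, mul_smul]; rfl⟩
  let β := Module.Basis.ofVectorSpace K L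
  have key : ∃ a : Module.Basis.ofVectorSpaceIndex K L →₀ A,
      x = a.sum fun k y => (k : L) • r y := by
    have hx : x ∈ Submodule.span L (Set.range r) := hr.span_eq_top ▸ Submodule.mem_top
    induction hx using Submodule.span_induction with
    | zero => exact ⟨0, by simp⟩
    | add x y _ _ hx hy =>
      obtain ⟨a, rfl⟩ := hx
      obtain ⟨a', rfl⟩ := hy
      exact ⟨a + a', by rw [Finsupp.sum_add_index'] <;> simp⟩
    | mem x hx =>
      obtain ⟨y, rfl⟩ := hx
      refine ⟨(β.repr 1).mapRange (fun c => c • y) (zero_smul _ _), ?_⟩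
      rw [Finsupp.sum_mapRange_index (by simp)]
      conv_lhs => rw [← one_smul L (r y), ← β.linearCombination_repr 1,
        Finsupp.linearCombination_apply, Finsupp.sum, Finset.sum_smul]
      refine Finset.sum_congr rfl fun k _ => ?_
      simp only [map_smulₛₗ, smul_smul, Algebra.smul_def, β, Module.Basis.ofVectorSpace_apply_self]
      rw [mul_comm]
      rfl
    | smul l x _ hx =>
      obtain ⟨a, rfl⟩ := hx
      refine ⟨a.sum fun k y => (β.repr (l * k)).mapRange (fun c => c • y) (zero_smul _ _), ?_⟩
      rw [Finsupp.sum_sum_index (by simp) (by simp [smul_add]), Finsupp.smul_sum]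
      refine Finset.sum_congr rfl fun k _ => ?_
      dsimp only
      rw [Finsupp.sum_mapRange_index (by simp), smul_smul]
      conv_lhs => rw [← β.linearCombination_repr (l * k),
        Finsupp.linearCombination_apply, Finsupp.sum, Finset.sum_smul]
      refine Finset.sum_congr rfl fun k _ => ?_
      simp only [map_smulₛₗ, smul_smul, Algebra.smul_def, β, Module.Basis.ofVectorSpace_apply_self]
      rw [mul_comm]
      rfl
  obtain ⟨a, ha⟩ := key
  refine ⟨a.support.map ⟨Subtype.val, Subtype.val_injective⟩,
    fun l => if h : l ∈ Module.Basis.ofVectorSpaceIndex K L then a ⟨l, h⟩ else 0,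
    fun g hg => ?_, ?_⟩
  · rw [Finset.sum_map] at hg
    have hli := β.linearIndependent
    rw [linearIndependent_iff'] at hli
    have := hli a.support (fun k => g k) (by
      simp only [β, Algebra.smul_def, Module.Basis.ofVectorSpace_apply_self]
      exact hg)
    simpa using this
  · rw [ha, Finset.sum_map]
    refine Finset.sum_congr rfl fun k _ => ?_
    simp

/-- For the harder inclusion write `x = ∑ k • r (a k)` with the `k` independent over `K`. A
coordinate of `act' x` is `∑ k * r (c k)`, where `c k` is that coordinate of `act (a k)`. If it
vanishes then so does each `c k`, hence every `a k` lies in the layer below. -/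
lemma span_coactionFiltration (r : A →+* A')
    (hrσ : r.comp (algebraMap K A) = (algebraMap L A').comp σ)
    (hr : IsScalarExtension (semilinearMap σ r hrσ))
    (ht : ∀ a, t (algebraMap A C a) = algebraMap A' C' (r a))
    (hb : ∀ m, t (b m) = b' m) (hta : ∀ a, t (act a) = act' (r a)) (s : Finset κ) :
    Submodule.span L (semilinearMap σ r hrσ '' (coactionFiltration b act hact s : Set A)) =
      coactionFiltration b' act' hact' s := by
  apply le_antisymm
  · rw [Submodule.span_le]
    rintro _ ⟨a, ha, rfl⟩ m hm
    change b'.repr (act' (r a)) m = 0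
    rw [← hta, repr_act_eq b b' t r ht hb, ha m hm, map_zero]
  · intro x hx
    obtain ⟨u, a, hu, rfl⟩ := hr.exists_eq_sum x
    refine Submodule.sum_mem _ fun k hk => Submodule.smul_mem _ _ (Submodule.subset_span
      ⟨a k, fun m hm => ?_, rfl⟩)
    refine hr.eq_zero_of_sum_smul_eq_zero u (fun k => k) hu (fun k => b.repr (act (a k)) m) ?_ k hk
    have h1 := hx m hm
    rw [map_sum, map_sum, Finsupp.finsetSum_apply] at h1
    rw [← h1]
    refine Finset.sum_congr rfl fun k _ => ?_
    rw [Algebra.smul_def, Algebra.smul_def, map_mul, hact',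
      ← Algebra.smul_def (algebraMap L A' k) (act' _), map_smul, Finsupp.smul_apply, smul_eq_mul]
    change _ * r _ = _ * (b'.repr (act' (r (a k)))) m
    rw [← hta, repr_act_eq b b' t r ht hb]

end FiltrationBaseChange
end TorsorPatching

namespace TorsorPatching

/-! ### Descent of affineness -/

section AffineDescent

variable {X Y S T : Scheme.{u}} {g : Y ⟶ X} {iY : Y ⟶ T} {iX : X ⟶ S} {f : T ⟶ S}

/-- Flat base change for global functions. `X` is only quasi-compact and quasi-separated, since its
affineness is what this serves to prove. -/
lemma isPushout_appTop_of_flat (H : IsPullback g iY iX f) [IsAffine S] [IsAffine T] [Flat f]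
    [CompactSpace X] [QuasiSeparatedSpace X] :
    IsPushout iX.appTop f.appTop g.appTop iY.appTop := by
  have h := isIso_pushoutSection_of_isQuasiSeparated_of_flat_right H (US := ⊤) (UT := ⊤)
    (UX := ⊤) (UY := ⊤) (f.preimage_top.ge) (iX.preimage_top.ge) (by simp) (isAffineOpen_top S)
    (isAffineOpen_top T)
    isCompact_univ isQuasiSeparated_univ
  have := (isIso_pushoutSection_iff ..).1 h
  have e {X Y : Scheme.{u}} (f : X ⟶ Y) (h) : f.appLE ⊤ ⊤ h = f.appTop := f.appLE_eq_app
  rwa [e, e, e, e] at this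

/-- Affineness of a scheme descends along faithfully flat base changes. -/
lemma isAffine_of_isPullback_of_flat (H : IsPullback g iY iX f) [IsAffine S] [IsAffine T]
    [IsAffine Y] [Flat f] [Surjective f] : IsAffine X := by
  have : IsAffineHom g := MorphismProperty.of_isPullback H.flip (inferInstanceAs (IsAffineHom f))
  have : Surjective g := MorphismProperty.of_isPullback H.flip (inferInstanceAs (Surjective f))
  -- Both finiteness properties of `X` pass down from `Y`: quasi-compact opens pull back to such
  -- opens along the affine map `g`, and images of compact sets are compact.
  have : CompactSpace X := by
    rw [← isCompact_univ_iff, ← g.surjective.range_eq]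
    exact isCompact_range g.continuous
  have : QuasiSeparatedSpace X := by
    refine ⟨fun U V hU hU' hV hV' => ?_⟩
    rw [← Set.image_preimage_eq (U ∩ V) g.surjective]
    refine IsCompact.image ?_ g.continuous
    rw [Set.preimage_inter]
    exact QuasiSeparatedSpace.inter_isCompact _ _ (hU.preimage g.continuous)
      (QuasiCompact.isCompact_preimage _ hU hU') (hV.preimage g.continuous)
      (QuasiCompact.isCompact_preimage _ hV hV')
  have h1 := isPullback_SpecMap_of_isPushout _ _ _ _ (isPushout_appTop_of_flat H)
  have h2 : IsPullback (Y.toSpecΓ ≫ Spec.map iY.appTop) g (Spec.map f.appTop)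
      (X.toSpecΓ ≫ Spec.map iX.appTop) := by
    rw [← Scheme.toSpecΓ_naturality, ← Scheme.toSpecΓ_naturality]
    exact H.flip.paste_horiz (IsPullback.of_horiz_isIso ⟨(Scheme.toSpecΓ_naturality f).symm⟩)
  -- So `X.toSpecΓ` becomes the isomorphism `Y.toSpecΓ` after base change along the faithfully flat
  -- map `Spec.map g.appTop`, and is itself an isomorphism by descent.
  have h3 := IsPullback.of_right h2 (Scheme.toSpecΓ_naturality g).symm h1.flip
  have hf : Spec.map f.appTop = inv T.toSpecΓ ≫ f ≫ S.toSpecΓ := by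
    rw [Scheme.toSpecΓ_naturality, IsIso.inv_hom_id_assoc]
  have : Flat (Spec.map f.appTop) := by rw [hf]; infer_instance
  have : Surjective (Spec.map f.appTop) := by rw [hf]; infer_instance
  have : Flat (Spec.map g.appTop) := MorphismProperty.of_isPullback h1.flip ‹_›
  have : Surjective (Spec.map g.appTop) := MorphismProperty.of_isPullback h1.flip ‹_›
  have h4 : MorphismProperty.isomorphisms Scheme X.toSpecΓ :=
    MorphismProperty.of_isPullback_of_descendsAlong
      (Q := @Surjective ⊓ @Flat ⊓ @QuasiCompact) h3 ⟨⟨‹_›, ‹_›⟩, inferInstance⟩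
      (inferInstanceAs (IsIso Y.toSpecΓ))
  exact ⟨h4⟩

end AffineDescent

variable {F : Type u} [Field F]

/-! ### Affineness of torsors -/

section Torsor

variable {G : Over (Spec (CommRingCat.of F))} [GrpObj G] {K : Type u} [Field K] [Algebra F K]

instance (Y : Over (Spec (CommRingCat.of F))) [IsAffine Y.left] [IsAffineHom G.hom] :
    IsAffine (Y ⊗ G).left :=
  inferInstanceAs (IsAffine (pullback Y.hom G.hom))

instance : IsAffine (specOver F K).left :=
  inferInstanceAs (IsAffine (Spec (CommRingCat.of K)))

instance : Subsingleton (specOver F K).left :=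
  inferInstanceAs (Subsingleton (PrimeSpectrum K))

instance : IsIntegral (specOver F K).left :=
  inferInstanceAs (IsIntegral (Spec (CommRingCat.of K)))

lemma surjective_of_nonempty {X : Scheme.{u}} [Nonempty X] (f : X ⟶ (specOver F K).left) :
    Surjective f :=
  ⟨fun _ => ⟨Classical.arbitrary X, Subsingleton.elim _ _⟩⟩

/-- A torsor under an affine group scheme is affine. -/
lemma Torsor.isAffine [IsAffineHom G.hom] (T : Torsor G K) : IsAffine T.X.left := by
  obtain ⟨x⟩ := T.nonempty
  obtain ⟨U, hU, hx, -⟩ := exists_isAffineOpen_mem_and_subset (U := ⊤) (x := x) trivial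
  have : IsAffine U := hU
  have : Nonempty U := ⟨⟨x, hx⟩⟩
  have H : IsPullback T.act.left (fst T.X G).left T.p.left T.p.left :=
    (T.isPullback.map (Over.forget _)).flip
  have : IsAffineHom (fst T.X G).left :=
    MorphismProperty.of_isPullback (IsPullback.of_hasPullback T.X.hom G.hom).flip ‹_›
  -- By the torsor condition, the base change of `T.X` along `U → Spec K` is `U × G`, which is
  -- affine. As `U` is nonempty, this map is flat and surjective.
  have H' := (IsPullback.of_hasPullback (fst T.X G).left U.ι).flip.paste_vert H.flip
  have := surjective_of_nonempty (U.ι ≫ T.p.left)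
  exact isAffine_of_isPullback_of_flat H'.flip

end Torsor

/-! ### Coordinate rings of base changes -/

section SpecPullback

variable {R R' : CommRingCat.{u}} {φ : R ⟶ R'} {Y Y' : Scheme.{u}} {q : Y' ⟶ Y}
  {p' : Y' ⟶ Spec R'} {p : Y ⟶ Spec R}

lemma toSpecΓ_SpecMap_appTop (p : Y ⟶ Spec R) :
    Y.toSpecΓ ≫ Spec.map ((Scheme.ΓSpecIso R).inv ≫ p.appTop) = p := by
  simp [← Scheme.toSpecΓ_naturality_assoc]

lemma ΓSpecIso_inv_appTop_comp (w : q ≫ p = p' ≫ Spec.map φ) :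
    ((Scheme.ΓSpecIso R).inv ≫ p.appTop) ≫ q.appTop =
      φ ≫ (Scheme.ΓSpecIso R').inv ≫ p'.appTop := by
  rw [Category.assoc, ← Scheme.Hom.comp_appTop, w, Scheme.Hom.comp_appTop,
    Scheme.ΓSpecIso_inv_naturality_assoc]

lemma isPushout_of_isPullback_Spec [IsAffine Y] (h : IsPullback q p' p (Spec.map φ)) :
    IsPushout φ ((Scheme.ΓSpecIso R).inv ≫ p.appTop) ((Scheme.ΓSpecIso R').inv ≫ p'.appTop)
      q.appTop := by
  refine (isPushout_appTop_of_isPullback h).flip.of_iso (Scheme.ΓSpecIso R) (Scheme.ΓSpecIso R')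
    (Iso.refl _) (Iso.refl _) ?_ ?_ ?_ ?_
  · exact Scheme.ΓSpecIso_naturality _
  · simp
  · simp
  · simp

end SpecPullback

section BaseChange

variable {K L : Type u} [Field K] [Field L] [Algebra F K] [Algebra F L]
  {Y Y' : Over (Spec (CommRingCat.of F))}

/-- The structure map from `K` to the ring of global functions of a `K`-scheme. -/
noncomputable def structureMap (p : Y ⟶ specOver F K) : K →+* Γ(Y.left, ⊤) :=
  ((Scheme.ΓSpecIso (CommRingCat.of K)).inv ≫
    Scheme.Hom.appTop (Y := Spec (CommRingCat.of K)) p.left).hom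

lemma appTop_comp_structureMap {f : K →ₐ[F] L} {q : Y' ⟶ Y} {p' : Y' ⟶ specOver F L}
    {p : Y ⟶ specOver F K} (w : q ≫ p = p' ≫ specMap f) :
    q.left.appTop.hom.comp (structureMap p) = (structureMap p').comp f.toRingHom := by
  exact congrArg CommRingCat.Hom.hom
    (ΓSpecIso_inv_appTop_comp (φ := CommRingCat.ofHom f.toRingHom) (p := p.left) (p' := p'.left)
      (congrArg CommaMorphism.left w))

lemma isPushout_structureMap {f : K →ₐ[F] L} {q : Y' ⟶ Y} {p' : Y' ⟶ specOver F L}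
    {p : Y ⟶ specOver F K} [IsAffine Y.left] (h : IsPullback q p' p (specMap f)) :
    IsPushout (CommRingCat.ofHom f.toRingHom) (CommRingCat.ofHom (structureMap p))
      (CommRingCat.ofHom (structureMap p')) q.left.appTop :=
  isPushout_of_isPullback_Spec (h.map (Over.forget _))

/-- A base change of a field extension is a faithfully flat quasi-compact cover. Being an
epimorphism, it allows equations between morphisms to be checked after the extension. -/
lemma epi_of_isPullback {f : K →ₐ[F] L} {q : Y' ⟶ Y} {p' : Y' ⟶ specOver F L}
    {p : Y ⟶ specOver F K} (h : IsPullback q p' p (specMap f)) :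
    Surjective q.left ∧ Flat q.left ∧ QuasiCompact q.left ∧ Epi q := by
  have h1 := (h.map (Over.forget _)).flip
  have : Nonempty (specOver F L).left := inferInstanceAs (Nonempty (PrimeSpectrum L))
  have := surjective_of_nonempty (specMap f).left
  have hs : Surjective q.left := MorphismProperty.of_isPullback h1 this
  have hf : Flat q.left :=
    MorphismProperty.of_isPullback h1 (inferInstanceAs (Flat (specMap f).left))
  have hq : QuasiCompact q.left :=
    MorphismProperty.of_isPullback h1 (inferInstanceAs (QuasiCompact (specMap f).left))
  have : Epi q.left := Flat.epi_of_flat_of_surjective _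
  exact ⟨hs, hf, hq, Over.epi_of_epi_left q⟩

end BaseChange
end TorsorPatching

namespace TorsorPatching

/-! ### Patching comodule algebras -/

section Pushout

variable {K A B C : Type u} [Field K] [CommRing A] [CommRing B] [CommRing C] [Algebra K B]
  [Algebra A C] {φ : K →+* A} {g : B →+* C}

/-- `C` is `A ⊗ B` over `K`. Here `A` is only a ring, so `IsScalarExtension` does not apply. -/
lemma exists_basis_of_isPushout {κ : Type*} (h : IsPushout (CommRingCat.ofHom φ)
      (CommRingCat.ofHom (algebraMap K B)) (CommRingCat.ofHom (algebraMap A C))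
      (CommRingCat.ofHom g))
    (e : Module.Basis κ K B) : ∃ b : Module.Basis κ A C, ∀ m, b m = g (e m) := by
  let := φ.toAlgebra
  let := g.toAlgebra
  let := ((algebraMap A C).comp φ).toAlgebra
  have : IsScalarTower K A C := .of_algebraMap_eq fun _ => rfl
  have : IsScalarTower K B C := .of_algebraMap_eq fun x =>
    RingHom.congr_fun (congrArg CommRingCat.Hom.hom h.w) x
  have : Algebra.IsPushout K A B C :=
    (CommRingCat.isPushout_iff_isPushout (R := K) (S := B) (R' := A) (S' := C)).1 h
  exact ⟨this.out.basis e, fun m => this.out.basis_apply e m⟩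

lemma linearIndependent_of_isPushout (h : IsPushout (CommRingCat.ofHom φ)
      (CommRingCat.ofHom (algebraMap K B)) (CommRingCat.ofHom (algebraMap A C))
      (CommRingCat.ofHom g)) {ι : Type*} {v : ι → B} (hv : LinearIndependent K v) :
    LinearIndependent A (g ∘ v) := by
  have hs := hv.linearIndepOn_id
  obtain ⟨b, hb⟩ := exists_basis_of_isPushout h (Module.Basis.extend hs)
  have h1 := b.linearIndependent.comp
    (fun i => (⟨v i, hs.subset_extend _ ⟨i, rfl⟩⟩ : hs.extend (Set.subset_univ _)))
    fun i j hij => hv.injective (by simpa using hij)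
  have h2 : (b ∘ fun i => (⟨v i, hs.subset_extend _ ⟨i, rfl⟩⟩ : hs.extend (Set.subset_univ _))) =
      g ∘ v := funext fun i => by simp [hb]
  rwa [h2] at h1

end Pushout

variable {F : Type u} [Field F] {I : Type} [Finite I] [PartialOrder I]
  (S : FactorizationInverseSystem F I)

/-- If `β` is essentially surjective, then patching works for a compatible system of algebras `A i`
with coactions `A i → C i = A i ⊗ H` such that `A i ⊗ A i ≅ A i ⊗ H`. -/
theorem FactorizationInverseSystem.isPushout_limit (hβ : S.vectBaseChange.EssSurj)
    {H : Type u} [CommRing H] [Algebra F H] {A C : I → Type u} [∀ i, CommRing (A i)]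
    [∀ i, CommRing (C i)] [∀ i, Nontrivial (A i)] [∀ i, Algebra (S.K i) (A i)]
    [∀ i, Algebra (A i) (C i)] (φ : ∀ i, F →+* A i) (g : ∀ i, H →+* C i)
    (act : ∀ i, A i →+* C i)
    (hg : ∀ i, IsPushout (CommRingCat.ofHom (φ i)) (CommRingCat.ofHom (algebraMap F H))
      (CommRingCat.ofHom (algebraMap (A i) (C i))) (CommRingCat.ofHom (g i)))
    (hact : ∀ i, IsPushout (CommRingCat.ofHom (algebraMap (S.K i) (A i)))
      (CommRingCat.ofHom (algebraMap (S.K i) (A i)))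
      (CommRingCat.ofHom (algebraMap (A i) (C i))) (CommRingCat.ofHom (act i)))
    (res : ∀ {i j : I}, i > j → (A i →+* A j)) (t : ∀ {i j : I}, i > j → (C i →+* C j))
    (hres : ∀ {i j : I} (h : i > j), IsPushout (CommRingCat.ofHom (S.incl h).toRingHom)
      (CommRingCat.ofHom (algebraMap (S.K i) (A i)))
      (CommRingCat.ofHom (algebraMap (S.K j) (A j))) (CommRingCat.ofHom (res h)))
    (ht : ∀ {i j : I} (h : i > j),
      (t h).comp (algebraMap (A i) (C i)) = (algebraMap (A j) (C j)).comp (res h))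
    (htg : ∀ {i j : I} (h : i > j), (t h).comp (g i) = g j)
    (hta : ∀ {i j : I} (h : i > j), (t h).comp (act i) = (act j).comp (res h))
    {B : Type u} [CommRing B] [Algebra F B] (π : ∀ i, B →+* A i)
    (hlim : IsInverseLimit (fun {_ _} h => res h) π)
    (hπ : ∀ i, (π i).comp (algebraMap F B) = (algebraMap (S.K i) (A i)).comp (algebraMap F (S.K i)))
    (i : I) :
    IsPushout (CommRingCat.ofHom (algebraMap F (S.K i))) (CommRingCat.ofHom (algebraMap F B))
      (CommRingCat.ofHom (algebraMap (S.K i) (A i))) (CommRingCat.ofHom (π i)) := by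
  let e := Module.Basis.ofVectorSpace F H
  -- All these bases come from the one basis `e` of `H`, so the filtrations for different `i` share
  -- an index set.
  choose b hb using fun i => exists_basis_of_isPushout (hg i) e
  have hact' (i) (k : S.K i) : act i (algebraMap (S.K i) (A i) k) =
      algebraMap (A i) (C i) (algebraMap (S.K i) (A i) k) :=
    (RingHom.congr_fun (congrArg CommRingCat.Hom.hom (hact i).w) k).symm
  have hresσ {i j : I} (h : i > j) : (res h).comp (algebraMap (S.K i) (A i)) =
      (algebraMap (S.K j) (A j)).comp (S.incl h).toRingHom :=
    (congrArg CommRingCat.Hom.hom (hres h).w).symm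
  rw [← isScalarExtension_iff_isPushout _ _ (hπ i)]
  have hext {i j : I} (h : i > j) := (isScalarExtension_iff_isPushout _ _ (hresσ h)).2 (hres h)
  refine S.isScalarExtension_limit hβ (fun h => semilinearMap _ _ (hresσ h)) hext
    (fun s i => coactionFiltration (b i) (act i) (hact' i) s)
    (fun i => coactionFiltration_mono _ _ _)
    (fun s i => finite_coactionFiltration _ _ _
      (fun v hv => linearIndependent_of_isPushout (hact i) hv) s)
    (fun i a => exists_mem_coactionFiltration _ _ _ a)
    (fun s {i j} h => span_coactionFiltration (b i) (act i) (hact' i) (b j) (act j) (hact' j) (t h)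
      (res h) (hresσ h) (hext h) (RingHom.congr_fun (ht h)) (fun m => ?_)
      (RingHom.congr_fun (hta h)) s)
    (fun i => semilinearMap _ _ (hπ i)) (fun h b => RingHom.congr_fun (hlim.1 h) b) hlim.2 i
  rw [hb, hb, ← htg h]
  rfl

/-! ### Gluing morphisms to affine schemes -/

/-- The `π i` are jointly injective, so the function built elementwise is a ring homomorphism. -/
lemma IsInverseLimit.exists_lift {I : Type} [PartialOrder I] {A : I → Type u} [∀ i, CommRing (A i)]
    {res : ∀ {i j : I}, i > j → (A i →+* A j)} {B : Type u} [CommRing B] {π : ∀ i, B →+* A i}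
    (hlim : IsInverseLimit (fun {_ _} h => res h) π) {D : Type u} [CommRing D]
    (f : ∀ i, D →+* A i) (hf : ∀ {i j : I} (h : i > j), (res h).comp (f i) = f j) :
    ∃ g : D →+* B, ∀ i, (π i).comp g = f i := by
  have hinj {b b' : B} (h : ∀ i, π i b = π i b') : b = b' :=
    (hlim.2 (fun i => π i b') fun h => RingHom.congr_fun (hlim.1 h) b').unique h fun _ => rfl
  choose g hg _ using fun d => hlim.2 (fun i => f i d) fun h => RingHom.congr_fun (hf h) d
  exact ⟨{ toFun := g
           map_one' := hinj fun i => by simp [hg]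
           map_mul' := fun x y => hinj fun i => by simp [hg]
           map_zero' := hinj fun i => by simp [hg]
           map_add' := fun x y => hinj fun i => by simp [hg] },
    fun i => RingHom.ext fun d => hg d i⟩

section Glue

variable {S} {Y : Over (Spec (CommRingCat.of F))} {p : Y ⟶ specOver F F}
  {Y' : I → Over (Spec (CommRingCat.of F))} {p' : ∀ i, Y' i ⟶ specOver F (S.K i)}
  {q : ∀ i, Y' i ⟶ Y} {τ : ∀ {i j : I}, i > j → (Y' j ⟶ Y' i)}

/-- The coordinate ring of an affine `F`-scheme is the inverse limit of the coordinate rings of its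
base changes to the `K i`. -/
lemma isInverseLimit_appTop [IsAffine Y.left]
    (hq : ∀ i, IsPullback (q i) (p' i) p (specMap (Algebra.ofId F (S.K i))))
    (hτp : ∀ {i j : I} (h : i > j), τ h ≫ p' i = p' j ≫ specMap (S.incl h))
    (hτq : ∀ {i j : I} (h : i > j), τ h ≫ q i = q j) :
    IsInverseLimit (A := fun i => Γ((Y' i).left, ⊤)) (fun {_ _} h => (τ h).left.appTop.hom)
      (fun i => (q i).left.appTop.hom) := by
  let := (structureMap p).toAlgebra
  let (i : I) := (structureMap (p' i)).toAlgebra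
  have hq' (i : I) : (q i).left.appTop.hom.comp (algebraMap F Γ(Y.left, ⊤)) =
      (algebraMap (S.K i) Γ((Y' i).left, ⊤)).comp (algebraMap F (S.K i)) :=
    appTop_comp_structureMap (hq i).w
  have hτ {i j : I} (h : i > j) :
      (τ h).left.appTop.hom.comp (algebraMap (S.K i) Γ((Y' i).left, ⊤)) =
      (algebraMap (S.K j) Γ((Y' j).left, ⊤)).comp (S.incl h).toRingHom :=
    appTop_comp_structureMap (hτp h)
  have hc {i j : I} (h : i > j) :
      (τ h).left.appTop.hom.comp (q i).left.appTop.hom = (q j).left.appTop.hom := by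
    rw [← hτq h, Over.comp_left, Scheme.Hom.comp_appTop, CommRingCat.hom_comp]
  refine ⟨hc, fun a ha => ?_⟩
  exact S.existsUnique_of_compatible (fun i => semilinearMap _ _ (hq' i))
    (fun i => (isScalarExtension_iff_isPushout _ _ (hq' i)).2 (isPushout_structureMap (hq i)))
    (fun h => semilinearMap _ _ (hτ h)) (fun h v => RingHom.congr_fun (hc h) v) a ha

/-- A compatible family of morphisms from the base changes of an affine `F`-scheme `Y` to an affine
scheme `Z` comes from a morphism from `Y` to `Z`. -/
lemma exists_hom_of_compatible [IsAffine Y.left]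
    (hq : ∀ i, IsPullback (q i) (p' i) p (specMap (Algebra.ofId F (S.K i))))
    (hτp : ∀ {i j : I} (h : i > j), τ h ≫ p' i = p' j ≫ specMap (S.incl h))
    (hτq : ∀ {i j : I} (h : i > j), τ h ≫ q i = q j)
    {Z : Over (Spec (CommRingCat.of F))} [IsAffine Z.left] (f : ∀ i, Y' i ⟶ Z) (hf : ∀ {i j : I} (h : i > j), τ h ≫ f i = f j) :
    ∃ g : Y ⟶ Z, ∀ i, q i ≫ g = f i := by
  obtain ⟨g, hg⟩ := (isInverseLimit_appTop hq hτp hτq).exists_lift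
    (fun i => (f i).left.appTop.hom) (fun {i j} h => by
      rw [← hf h, Over.comp_left, Scheme.Hom.comp_appTop, CommRingCat.hom_comp])
  let g' : Y.left ⟶ Z.left :=
    Y.left.toSpecΓ ≫ Spec.map (CommRingCat.ofHom g) ≫ inv Z.left.toSpecΓ
  have hg' (i : I) : (q i).left ≫ g' = (f i).left := by
    rw [← cancel_mono Z.left.toSpecΓ]
    simp only [g', Category.assoc, IsIso.inv_hom_id, Category.comp_id]
    rw [Scheme.toSpecΓ_naturality_assoc, Scheme.toSpecΓ_naturality, ← Spec.map_comp]
    congr 2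
    exact CommRingCat.hom_ext (hg i)
  obtain ⟨i⟩ := S.nonempty_index
  have hepi := (epi_of_isPullback (hq i)).1
  have := (epi_of_isPullback (hq i)).2.1
  have : Epi (q i).left := Flat.epi_of_flat_of_surjective _
  refine ⟨Over.homMk g' ?_, fun i => Over.OverMorphism.ext (hg' i)⟩
  -- That `g'` lies over `F` is tested after one faithfully flat `q i`.
  rw [← cancel_epi (q i).left, ← Category.assoc, hg' i, Over.w, Over.w]

end Glue
end TorsorPatching

namespace TorsorPatching

variable {F : Type u} [Field F] {I : Type} [Finite I] [PartialOrder I]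
  {S : FactorizationInverseSystem F I} {G : Over (Spec (CommRingCat.of F))} [GrpObj G]

/-! ### Transition maps of torsor patching problems -/

/-- The isomorphism of schemes underlying an isomorphism of torsors. -/
@[simps]
def Torsor.isoX {K : Type u} [Field K] [Algebra F K] {T T' : Torsor G K} (e : T ≅ T') :
    T.X ≅ T'.X where
  hom := e.hom.hom
  inv := e.inv.hom
  hom_inv_id := congrArg Torsor.Hom.hom e.hom_inv_id
  inv_hom_id := congrArg Torsor.Hom.hom e.inv_hom_id

namespace TorsorPatchingProblem

variable (P Q : TorsorPatchingProblem S G)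

/-- The morphism `T j ≅ T i ×_{K i} K j ⟶ T i`. -/
noncomputable def trans {i j : I} (h : i > j) : (P.T j).X ⟶ (P.T i).X :=
  (P.ν h).inv.hom ≫ (P.T i).proj (S.incl h)

lemma ν_hom_trans {i j : I} (h : i > j) :
    (P.ν h).hom.hom ≫ P.trans h = (P.T i).proj (S.incl h) :=
  (Torsor.isoX (P.ν h)).hom_inv_id_assoc _

lemma isPullback_trans {i j : I} (h : i > j) :
    IsPullback (P.trans h) (P.T j).p (P.T i).p (specMap (S.incl h)) :=
  (Torsor.isPullback_proj (S.incl h) (P.T i)).of_iso (Torsor.isoX (P.ν h)) (Iso.refl _)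
    (Iso.refl _) (Iso.refl _) (by simp [ν_hom_trans]) (by simp [Torsor.Hom.w]) (by simp) (by simp)

lemma act_trans {i j : I} (h : i > j) :
    (P.T j).act ≫ P.trans h = P.trans h ▷ G ≫ (P.T i).act := by
  rw [trans, ← Category.assoc, (P.ν h).inv.equivariant, Category.assoc, Torsor.proj_act,
    comp_whiskerRight, Category.assoc]

variable {P Q}

/-- Recasts compatibility with the `ν` as commuting squares of schemes, the form that the gluing
lemmas take. -/
lemma trans_naturality (φ : P ⟶ Q) {i j : I} (h : i > j) :
    P.trans h ≫ (φ.hom i).hom = (φ.hom j).hom ≫ Q.trans h := by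
  rw [← cancel_epi (Torsor.isoX (P.ν h)).hom]
  have h1 := congrArg Torsor.Hom.hom (φ.comm h)
  simp only [Torsor.comp_hom] at h1
  rw [Torsor.isoX_hom, ← Category.assoc, ν_hom_trans, ← Category.assoc, ← h1, Category.assoc,
    ν_hom_trans, Torsor.map_proj]

/-- An isomorphism of patching problems from a compatible family of isomorphisms of torsors. -/
def isoMk (e : ∀ i, P.T i ≅ Q.T i) (comm : ∀ {i j : I} (h : i > j),
    (Torsor.baseChange (S.incl h)).map (e i).hom ≫ (Q.ν h).hom = (P.ν h).hom ≫ (e j).hom) :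
    P ≅ Q where
  hom := ⟨fun i => (e i).hom, comm⟩
  inv := ⟨fun i => (e i).inv, fun {i j} h => by
    rw [← cancel_mono (e j).hom, Category.assoc, ← comm h, ← Category.assoc, ← Functor.map_comp,
      Iso.inv_hom_id, CategoryTheory.Functor.map_id, Category.id_comp, Category.assoc, Iso.inv_hom_id,
      Category.comp_id]⟩
  hom_inv_id := Hom.ext (funext fun i => (e i).hom_inv_id)
  inv_hom_id := Hom.ext (funext fun i => (e i).inv_hom_id)

/-- The components of an isomorphism of patching problems. -/
def isoApp (e : P ≅ Q) (i : I) : P.T i ≅ Q.T i where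
  hom := e.hom.hom i
  inv := e.inv.hom i
  hom_inv_id := congrArg (fun f : Hom P P => f.hom i) e.hom_inv_id
  inv_hom_id := congrArg (fun f : Hom Q Q => f.hom i) e.inv_hom_id

end TorsorPatchingProblem

open TorsorPatchingProblem

/-! ### Projections from the base changes of a torsor over `F` -/

section Projection

variable (S) (T : Torsor G F)

/-- The projection `T ×_F K i ⟶ T`. -/
noncomputable def torsorProj (i : I) : (((S.torsorBaseChange G).obj T).T i).X ⟶ T.X :=
  T.proj (Algebra.ofId F (S.K i))

lemma isPullback_torsorProj (i : I) :
    IsPullback (torsorProj S T i) (((S.torsorBaseChange G).obj T).T i).p T.p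
      (specMap (Algebra.ofId F (S.K i))) :=
  Torsor.isPullback_proj _ T

lemma act_torsorProj (i : I) :
    (((S.torsorBaseChange G).obj T).T i).act ≫ torsorProj S T i = torsorProj S T i ▷ G ≫ T.act :=
  Torsor.proj_act _ T

lemma map_torsorProj {T T' : Torsor G F} (φ : T ⟶ T') (i : I) :
    (((S.torsorBaseChange G).map φ).hom i).hom ≫ torsorProj S T' i = torsorProj S T i ≫ φ.hom :=
  Torsor.map_proj _ φ

lemma ν_hom_torsorProj {i j : I} (h : i > j) :
    (((S.torsorBaseChange G).obj T).ν h).hom.hom ≫ torsorProj S T j =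
      (((S.torsorBaseChange G).obj T).T i).proj (S.incl h) ≫ torsorProj S T i :=
  Torsor.baseChangeTrans_proj _ _ _ (Subsingleton.elim _ _) T

lemma trans_torsorProj {i j : I} (h : i > j) :
    ((S.torsorBaseChange G).obj T).trans h ≫ torsorProj S T i = torsorProj S T j := by
  rw [← cancel_epi (Torsor.isoX (((S.torsorBaseChange G).obj T).ν h)).hom, Torsor.isoX_hom,
    ← Category.assoc, ν_hom_trans, ν_hom_torsorProj]

end Projection

/-- The coordinate ring of a solution is the inverse limit of the coordinate rings. -/
lemma isInverseLimit_solutionRes [IsAffineHom G.hom] {P : TorsorPatchingProblem S G}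
    {T : Torsor G F} (e : (S.torsorBaseChange G).obj T ≅ P) :
    IsInverseLimit (fun {_ _} h => P.res h) (fun i => solutionRes e i) := by
  have := T.isAffine
  refine isInverseLimit_appTop (p := T.p) (p' := fun i => (P.T i).p)
    (q := fun i => (e.inv.hom i).hom ≫ torsorProj S T i) (fun i => ?_)
    (τ := fun h => P.trans h) (fun h => (P.isPullback_trans h).w) (fun {i j} h => ?_)
  · refine (isPullback_torsorProj S T i).of_iso (Torsor.isoX (isoApp e i))
      (Iso.refl _) (Iso.refl _) (Iso.refl _) ?_ ?_ (by simp) (by simp)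
    · rw [Iso.refl_hom, Category.comp_id]
      exact ((Torsor.isoX (isoApp e i)).hom_inv_id_assoc _).symm
    · rw [Iso.refl_hom, Category.comp_id]
      exact (e.hom.hom i).w.symm
  · rw [← Category.assoc, trans_naturality e.inv h, Category.assoc, trans_torsorProj]

/-! ### The base change functor is fully faithful -/

lemma isPullback_whiskerRight {Y Y' : Over (Spec (CommRingCat.of F))} (q : Y' ⟶ Y)
    (Z : Over (Spec (CommRingCat.of F))) : IsPullback (q ▷ Z) (fst Y' Z) (fst Y Z) q := by
  refine ⟨⟨whiskerRight_fst _ _⟩, ⟨PullbackCone.IsLimit.mk _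
    (fun s => lift s.snd (s.fst ≫ snd _ _)) (fun s => ?_) (fun s => ?_) fun s m h₁ h₂ => ?_⟩⟩
  · apply CartesianMonoidalCategory.hom_ext
    · rw [Category.assoc, whiskerRight_fst, lift_fst_assoc, s.condition]
    · rw [Category.assoc, whiskerRight_snd, lift_snd]
  · rw [lift_fst]
  · apply CartesianMonoidalCategory.hom_ext
    · rw [lift_fst, h₂]
    · rw [lift_snd, ← h₁, Category.assoc, whiskerRight_snd]

section

variable {K L : Type u} [Field K] [Field L] [Algebra F K] [Algebra F L]
  {Y Y' : Over (Spec (CommRingCat.of F))} {f : K →ₐ[F] L} {q : Y' ⟶ Y} {p' : Y' ⟶ specOver F L}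
  {p : Y ⟶ specOver F K}

/-- Makes gluing and descent available for `Y × Z` too, so that actions and their axioms can be
treated like morphisms from `Y`. -/
lemma isPullback_whiskerRight_specMap (h : IsPullback q p' p (specMap f))
    (Z : Over (Spec (CommRingCat.of F))) :
    IsPullback (q ▷ Z) (fst Y' Z ≫ p') (fst Y Z ≫ p) (specMap f) :=
  (isPullback_whiskerRight q Z).paste_vert h

lemma epi_whiskerRight (h : IsPullback q p' p (specMap f))
    (Z : Over (Spec (CommRingCat.of F))) : Epi (q ▷ Z) :=
  (epi_of_isPullback (isPullback_whiskerRight_specMap h Z)).2.2.2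

end

/-- The maps `T ×_F K i → T' ×_F K i → T'` are compatible and glue, because `T` and `T'` are affine.
Equivariance of the result is checked after one epimorphic projection. -/
lemma full_torsorBaseChange [IsAffineHom G.hom] : (S.torsorBaseChange G).Full where
  map_surjective {T T'} φ := by
    have := T.isAffine
    have := T'.isAffine
    obtain ⟨g, hg⟩ := exists_hom_of_compatible (isPullback_torsorProj S T) (τ := fun h =>
      ((S.torsorBaseChange G).obj T).trans h)
      (fun h => (((S.torsorBaseChange G).obj T).isPullback_trans h).w)
      (fun h => trans_torsorProj S T h)
      (fun i => (φ.hom i).hom ≫ torsorProj S T' i)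
      (fun {i j} h => by
        rw [← Category.assoc, trans_naturality φ h, Category.assoc, trans_torsorProj])
    obtain ⟨i⟩ := S.nonempty_index
    have h1 : Epi (torsorProj S T i) := (epi_of_isPullback (isPullback_torsorProj S T i)).2.2.2
    have h2 := epi_whiskerRight (isPullback_torsorProj S T i) G
    refine ⟨⟨g, ?_, ?_⟩, ?_⟩
    · rw [← cancel_epi (torsorProj S T i), ← Category.assoc, hg, Category.assoc,
        (isPullback_torsorProj S T' i).w, (isPullback_torsorProj S T i).w, ← Category.assoc,
        (φ.hom i).w]
    · rw [← cancel_epi (torsorProj S T i ▷ G), ← Category.assoc, ← act_torsorProj,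
        Category.assoc, hg, ← comp_whiskerRight_assoc, hg, comp_whiskerRight_assoc,
        ← act_torsorProj, ← Category.assoc, ← Category.assoc, (φ.hom i).equivariant]
    · apply TorsorPatchingProblem.Hom.ext
      funext i
      apply Torsor.hom_ext
      apply (isPullback_torsorProj S T' i).hom_ext
      · exact (map_torsorProj S _ i).trans (hg i)
      · rw [Torsor.Hom.w, Torsor.Hom.w]

lemma faithful_torsorBaseChange : (S.torsorBaseChange G).Faithful where
  map_injective {T T'} φ ψ h := by
    obtain ⟨i⟩ := S.nonempty_index
    have : Epi (torsorProj S T i) := (epi_of_isPullback (isPullback_torsorProj S T i)).2.2.2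
    apply Torsor.hom_ext
    rw [← cancel_epi (torsorProj S T i), ← map_torsorProj, ← map_torsorProj, h]

end TorsorPatching

namespace TorsorPatching

variable {F : Type u} [Field F] {I : Type} [Finite I] [PartialOrder I]
  {S : FactorizationInverseSystem F I} {G : Over (Spec (CommRingCat.of F))} [GrpObj G]

open TorsorPatchingProblem

/-! ### Existence of solutions -/

lemma isPushout_of_isPullback_over_Spec {R : CommRingCat.{u}} {P X Y : Scheme.{u}} {q : P ⟶ X}
    {r : P ⟶ Y} {f : X ⟶ Spec R} {g : Y ⟶ Spec R} [IsAffine X] [IsAffine Y]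
    (h : IsPullback q r f g) :
    IsPushout ((Scheme.ΓSpecIso R).inv ≫ f.appTop) ((Scheme.ΓSpecIso R).inv ≫ g.appTop)
      q.appTop r.appTop :=
  (isPushout_appTop_of_isPullback h).of_iso (Scheme.ΓSpecIso R) (Iso.refl _) (Iso.refl _)
    (Iso.refl _) (by simp) (by simp) (by simp) (by simp)

lemma isPullback_toSpecΓ_of_isPushout {R R' A : CommRingCat.{u}} {φ : R ⟶ R'} {a : R ⟶ A}
    {X : Scheme.{u}} [IsAffine X] {p : X ⟶ Spec R'} {π : A ⟶ Γ(X, ⊤)}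
    (h : IsPushout φ a ((Scheme.ΓSpecIso R').inv ≫ p.appTop) π) :
    IsPullback (X.toSpecΓ ≫ Spec.map π) p (Spec.map a) (Spec.map φ) := by
  refine (isPullback_SpecMap_of_isPushout _ _ _ _ h).flip.of_iso (asIso X.toSpecΓ).symm
    (Iso.refl _) (Iso.refl _) (Iso.refl _) ?_ ?_ (by simp) (by simp)
  · simp
  · rw [Iso.symm_hom, Iso.eq_inv_comp, Iso.refl_hom, Category.comp_id, asIso_hom,
      toSpecΓ_SpecMap_appTop]

/-- The algebraic patching theorem in terms of morphisms of commutative rings. -/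
lemma FactorizationInverseSystem.isPushout_limit_of_commRingCat (hβ : S.vectBaseChange.EssSurj)
    {H : CommRingCat.{u}} {c : CommRingCat.of F ⟶ H} {A C : I → CommRingCat.{u}}
    [∀ i, Nontrivial (A i)] (s : ∀ i, CommRingCat.of (S.K i) ⟶ A i) (d : ∀ i, A i ⟶ C i)
    (φ : ∀ i, CommRingCat.of F ⟶ A i) (g : ∀ i, H ⟶ C i) (act : ∀ i, A i ⟶ C i)
    (hg : ∀ i, IsPushout (φ i) c (d i) (g i)) (hact : ∀ i, IsPushout (s i) (s i) (d i) (act i))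
    (res : ∀ {i j : I}, i > j → (A i ⟶ A j)) (t : ∀ {i j : I}, i > j → (C i ⟶ C j))
    (hres : ∀ {i j : I} (h : i > j),
      IsPushout (CommRingCat.ofHom (S.incl h).toRingHom) (s i) (s j) (res h))
    (ht : ∀ {i j : I} (h : i > j), d i ≫ t h = res h ≫ d j)
    (htg : ∀ {i j : I} (h : i > j), g i ≫ t h = g j)
    (hta : ∀ {i j : I} (h : i > j), act i ≫ t h = res h ≫ act j)
    {B : CommRingCat.{u}} (b : CommRingCat.of F ⟶ B) (π : ∀ i, B ⟶ A i)
    (hlim : IsInverseLimit (fun {_ _} h => (res h).hom) (fun i => (π i).hom))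
    (hπ : ∀ i, b ≫ π i = CommRingCat.ofHom (algebraMap F (S.K i)) ≫ s i) (i : I) :
    IsPushout (CommRingCat.ofHom (algebraMap F (S.K i))) b (s i) (π i) := by
  let (i : I) : Algebra (S.K i) (A i) := (s i).hom.toAlgebra
  let (i : I) : Algebra (A i) (C i) := (d i).hom.toAlgebra
  let : Algebra F H := c.hom.toAlgebra
  let : Algebra F B := b.hom.toAlgebra
  exact S.isPushout_limit hβ (A := fun i => A i) (C := fun i => C i) (fun i => (φ i).hom)
    (fun i => (g i).hom) (fun i => (act i).hom) hg hact (fun h => (res h).hom)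
    (fun h => (t h).hom) hres (fun h => congrArg CommRingCat.Hom.hom (ht h))
    (fun h => congrArg CommRingCat.Hom.hom (htg h))
    (fun h => congrArg CommRingCat.Hom.hom (hta h)) (fun i => (π i).hom) hlim
    (fun i => congrArg CommRingCat.Hom.hom (hπ i)) i

namespace TorsorPatchingProblem

variable (P : TorsorPatchingProblem S G)

/-- The inverse limit of the coordinate rings of a patching problem. -/
noncomputable def limitRing : Subring (∀ i, (P.T i).coordinateRing) where
  carrier := {a | ∀ {i j : I} (h : i > j), P.res h (a i) = a j}
  mul_mem' ha hb i j h := by simp [ha h, hb h]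
  one_mem' h := by simp
  add_mem' ha hb i j h := by simp [ha h, hb h]
  zero_mem' h := by simp
  neg_mem' ha i j h := by simp [ha h]

/-- The projections from the inverse limit. -/
noncomputable def limitProj (i : I) : P.limitRing →+* (P.T i).coordinateRing :=
  (Pi.evalRingHom _ i).comp P.limitRing.subtype

lemma isInverseLimit_limitProj : IsInverseLimit (fun {_ _} h => P.res h) P.limitProj :=
  ⟨fun h => RingHom.ext fun b => b.2 h, fun a ha =>
    ⟨⟨a, ha⟩, fun _ => rfl, fun _ hb => Subtype.ext (funext hb)⟩⟩

lemma res_comp_structureMap {i j : I} (h : i > j) :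
    (P.res h).comp (structureMap (P.T i).p) =
      (structureMap (P.T j).p).comp (S.incl h).toRingHom :=
  appTop_comp_structureMap (P.isPullback_trans h).w

/-- The structure map of the inverse limit. -/
noncomputable def limitAlgebraMap : F →+* P.limitRing :=
  (RingHom.pi fun i => (structureMap (P.T i).p).comp (algebraMap F (S.K i))).codRestrict _
    fun x i j h => by
      have h1 := RingHom.congr_fun (P.res_comp_structureMap h) (algebraMap F (S.K i) x)
      refine h1.trans ?_
      exact congrArg (structureMap (P.T j).p) ((S.incl h).commutes x)

/-- Feeds the geometry to the algebraic theorem, with `H` the coordinate ring of `G` and `C i` that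
of `T i × G`. The product square over `F` gives `C i = A i ⊗ H`; the torsor square gives `C i = A i
⊗ A i`. -/
lemma isPushout_limitProj [IsAffineHom G.hom] (hβ : S.vectBaseChange.EssSurj) (i : I) :
    IsPushout (CommRingCat.ofHom (algebraMap F (S.K i))) (CommRingCat.ofHom P.limitAlgebraMap)
      (CommRingCat.ofHom (structureMap (P.T i).p)) (CommRingCat.ofHom (P.limitProj i)) := by
  have (i : I) : IsAffine (P.T i).X.left := (P.T i).isAffine
  have : IsAffine G.left := isAffine_of_isAffineHom G.hom
  have (i : I) : Nontrivial Γ((P.T i).X.left, ⊤) :=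
    have : Nonempty (⊤ : (P.T i).X.left.Opens) := ⟨⟨(P.T i).nonempty.some, trivial⟩⟩
    Scheme.component_nontrivial _ ⊤
  refine S.isPushout_limit_of_commRingCat hβ
    (c := (Scheme.ΓSpecIso (CommRingCat.of F)).inv ≫ G.hom.appTop)
    (A := fun i => Γ((P.T i).X.left, ⊤)) (C := fun i => Γ(((P.T i).X ⊗ G).left, ⊤))
    (fun i => CommRingCat.ofHom (structureMap (P.T i).p))
    (fun i => (fst (P.T i).X G).left.appTop)
    (fun i => ((Scheme.ΓSpecIso (CommRingCat.of F)).inv ≫ (P.T i).X.hom.appTop))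
    (fun i => (snd (P.T i).X G).left.appTop) (fun i => (P.T i).act.left.appTop)
    (fun i => isPushout_of_isPullback_over_Spec (IsPullback.of_hasPullback (P.T i).X.hom G.hom))
    (fun i => isPushout_of_isPullback_over_Spec (R := CommRingCat.of (S.K i))
      ((P.T i).isPullback.map (Over.forget _)))
    (fun h => (P.trans h).left.appTop) (fun h => (P.trans h ▷ G).left.appTop)
    (fun h => isPushout_structureMap (P.isPullback_trans h))
    (fun h => ?_) (fun h => ?_) (fun h => ?_)
    (B := CommRingCat.of P.limitRing) (CommRingCat.ofHom P.limitAlgebraMap)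
    (fun i => CommRingCat.ofHom (P.limitProj i)) P.isInverseLimit_limitProj (fun i => rfl) i
  · rw [← Scheme.Hom.comp_appTop, ← Scheme.Hom.comp_appTop, ← Over.comp_left, ← Over.comp_left,
      whiskerRight_fst]
  · rw [← Scheme.Hom.comp_appTop, ← Over.comp_left, whiskerRight_snd]
  · rw [← Scheme.Hom.comp_appTop, ← Scheme.Hom.comp_appTop, ← Over.comp_left, ← Over.comp_left,
      act_trans]

/-- The affine scheme obtained by patching. -/
noncomputable def patch : Over (Spec (CommRingCat.of F)) :=
  Over.mk (Spec.map (CommRingCat.ofHom P.limitAlgebraMap))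

/-- The structure morphism of `P.patch`. -/
noncomputable def patchStr : P.patch ⟶ specOver F F :=
  Over.homMk (Spec.map (CommRingCat.ofHom P.limitAlgebraMap)) (by
    simp only [specOver, patch, Over.mk_hom, Algebra.algebraMap_self]
    exact (congrArg _ (Spec.map_id _)).trans (Category.comp_id _))

instance : IsAffine P.patch.left :=
  inferInstanceAs (IsAffine (Spec (CommRingCat.of P.limitRing)))

/-- The morphism from `T i` to the patched scheme. -/
noncomputable def toPatch (i : I) : (P.T i).X ⟶ P.patch :=
  Over.homMk ((P.T i).X.left.toSpecΓ ≫ Spec.map (CommRingCat.ofHom (P.limitProj i))) (by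
    have h1 : CommRingCat.ofHom P.limitAlgebraMap ≫ CommRingCat.ofHom (P.limitProj i) =
      CommRingCat.ofHom (algebraMap F (S.K i)) ≫ CommRingCat.ofHom (structureMap (P.T i).p) := rfl
    change (_ ≫ _) ≫ Spec.map _ = _
    rw [Category.assoc, ← Spec.map_comp, h1, Spec.map_comp, ← Category.assoc]
    refine Eq.trans ?_ (Over.w (P.T i).p)
    exact congrArg (· ≫ _) (toSpecΓ_SpecMap_appTop (R := CommRingCat.of (S.K i)) (P.T i).p.left))

lemma isPullback_toPatch [IsAffineHom G.hom] (hβ : S.vectBaseChange.EssSurj) (i : I) :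
    IsPullback (P.toPatch i) (P.T i).p P.patchStr (specMap (Algebra.ofId F (S.K i))) := by
  have : IsAffine (P.T i).X.left := (P.T i).isAffine
  have h := isPullback_toSpecΓ_of_isPushout (p := (P.T i).p.left) (P.isPushout_limitProj hβ i)
  exact IsPullback.of_map (Over.forget _) (Over.OverMorphism.ext h.w) h

lemma trans_toPatch {i j : I} (h : i > j) : P.trans h ≫ P.toPatch i = P.toPatch j := by
  apply Over.OverMorphism.ext
  have h1 : (P.trans h).left ≫ (P.T i).X.left.toSpecΓ ≫
      Spec.map (CommRingCat.ofHom (P.limitProj i)) =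
      (P.T j).X.left.toSpecΓ ≫ Spec.map (CommRingCat.ofHom (P.limitProj j)) := by
    rw [Scheme.toSpecΓ_naturality_assoc, ← Spec.map_comp]
    congr 2
    exact CommRingCat.hom_ext (P.isInverseLimit_limitProj.1 h)
  exact h1

end TorsorPatchingProblem
end TorsorPatching

/-! ### The action on the patched scheme -/

namespace TorsorPatching

variable {F : Type u} [Field F] {G : Over (Spec (CommRingCat.of F))}

/-- An action that becomes simply transitive after a field extension is simply transitive. -/
lemma isPullback_fst_act_of_isPullback {K L : Type u} [Field K] [Field L] [Algebra F K]
    [Algebra F L] {f : K →ₐ[F] L} {X X' : Over (Spec (CommRingCat.of F))} {q : X' ⟶ X}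
    {p' : X' ⟶ specOver F L} {p : X ⟶ specOver F K} (hq : IsPullback q p' p (specMap f))
    {act : X ⊗ G ⟶ X} {act' : X' ⊗ G ⟶ X'} (w : fst X G ≫ p = act ≫ p)
    (hact : q ▷ G ≫ act = act' ≫ q) (h : IsPullback (fst X' G) act' p' p') :
    IsPullback (fst X G) act p p := by
  let c : X ⊗ G ⟶ pullback p p := pullback.lift (fst X G) act w
  have hc : c ≫ pullback.fst p p = fst X G := pullback.lift_fst _ _ _
  have hc' : c ≫ pullback.snd p p = act := pullback.lift_snd _ _ _
  have h1 : IsPullback (act' ≫ q) (fst X' G) p (p' ≫ specMap f) := h.flip.paste_horiz hq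
  -- The simply transitive action on `X'` identifies `X' × G` with the base change of `X ×_K X`
  -- along `q`.
  have h2 : IsPullback (q ▷ G ≫ c) (fst X' G) (pullback.fst p p) q := by
    refine IsPullback.of_right (h₁₂ := pullback.snd p p) (h₂₂ := p) ?_ ?_
      (IsPullback.of_hasPullback p p).flip
    · rw [Category.assoc, hc', hact, hq.w]
      exact h1
    · rw [Category.assoc, hc, whiskerRight_fst]
  -- The base change of `c` along the cover `q ▷ G ≫ c` is an identity, so `c` is an isomorphism by
  -- descent.
  have h3 : IsPullback (q ▷ G) (𝟙 _) c (q ▷ G ≫ c) := by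
    refine IsPullback.of_bot (v₂₁ := fst X' G) (v₂₂ := pullback.fst p p) (h₃₁ := q) ?_ (by simp) h2
    rw [hc, Category.id_comp]
    exact isPullback_whiskerRight q G
  obtain ⟨h4, h5, h6, -⟩ := epi_of_isPullback (h2.paste_vert hq)
  have h7 : IsIso ((Over.forget _).map c) :=
    MorphismProperty.of_isPullback_of_descendsAlong
      (P := MorphismProperty.isomorphisms Scheme.{u})
      (Q := @Surjective ⊓ @Flat ⊓ @QuasiCompact) ((h3.map (Over.forget _)).flip) ⟨⟨h4, h5⟩, h6⟩
      (by simpa using MorphismProperty.isomorphisms.infer_property _)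
  have h8 : IsIso c := isIso_of_reflects_iso c (Over.forget _)
  exact IsPullback.of_iso_pullback ⟨w⟩ (asIso c) hc hc'

variable [GrpObj G] {I : Type} [Finite I] [PartialOrder I] {S : FactorizationInverseSystem F I}

namespace TorsorPatchingProblem

variable (P : TorsorPatchingProblem S G)

lemma exists_patchAct [IsAffineHom G.hom] (hβ : S.vectBaseChange.EssSurj) :
    ∃ act : P.patch ⊗ G ⟶ P.patch, ∀ i, P.toPatch i ▷ G ≫ act = (P.T i).act ≫ P.toPatch i :=
  exists_hom_of_compatible
    (fun i => isPullback_whiskerRight_specMap (P.isPullback_toPatch hβ i) G)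
    (τ := fun h => P.trans h ▷ G)
    (fun h => by
      rw [whiskerRight_fst_assoc, (P.isPullback_trans h).w, Category.assoc])
    (fun h => by rw [← comp_whiskerRight, trans_toPatch])
    (fun i => (P.T i).act ≫ P.toPatch i)
    (fun h => by rw [← Category.assoc, ← act_trans, Category.assoc, trans_toPatch])

/-- The action axioms hold after composition with epimorphisms from the products of `T i` with `G`,
for a single `i`; simple transitivity descends from that `T i`. -/
lemma exists_torsor_patch [IsAffineHom G.hom] (hβ : S.vectBaseChange.EssSurj) :
    ∃ act : P.patch ⊗ G ⟶ P.patch, P.patch ◁ MonObj.one ≫ act = (ρ_ P.patch).hom ∧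
      (α_ P.patch G G).hom ≫ P.patch ◁ MonObj.mul ≫ act = act ▷ G ≫ act ∧
      IsPullback (fst P.patch G) act P.patchStr P.patchStr ∧
      ∀ i, P.toPatch i ▷ G ≫ act = (P.T i).act ≫ P.toPatch i := by
  obtain ⟨act, hact⟩ := P.exists_patchAct hβ
  obtain ⟨i⟩ := S.nonempty_index
  have hq := P.isPullback_toPatch hβ i
  refine ⟨act, ?_, ?_, ?_, hact⟩
  · have := epi_whiskerRight hq (𝟙_ _)
    rw [← cancel_epi (P.toPatch i ▷ 𝟙_ _), ← whisker_exchange_assoc, hact, rightUnitor_naturality,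
      ← Category.assoc, (P.T i).act_one]
  · have := epi_whiskerRight (isPullback_whiskerRight_specMap hq G) G
    rw [← cancel_epi ((P.toPatch i ▷ G) ▷ G), ← comp_whiskerRight_assoc, hact,
      comp_whiskerRight_assoc, hact, ← Category.assoc ((P.T i).act ▷ G), ← (P.T i).act_mul,
      associator_naturality_left_assoc, ← whisker_exchange_assoc, hact]
    simp only [Category.assoc]
  · have := epi_whiskerRight hq G
    refine isPullback_fst_act_of_isPullback hq ?_ (hact i) (P.T i).isPullback
    rw [← cancel_epi (P.toPatch i ▷ G), whiskerRight_fst_assoc, hq.w, ← Category.assoc _ act, hact,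
      Category.assoc, hq.w, ← Category.assoc, ← Category.assoc, (P.T i).isPullback.w]

end TorsorPatchingProblem

open TorsorPatchingProblem

/-- `T i` and the base change of the patched torsor are pullbacks of the same cospan. The resulting
canonical isomorphisms commute with actions and transition maps, since both can be compared after
projection to `P.patch` and to the base field. -/
lemma essSurj_torsorBaseChange [IsAffineHom G.hom] (hβ : S.vectBaseChange.EssSurj) :
    (S.torsorBaseChange G).EssSurj where
  mem_essImage P := by
    obtain ⟨act, h1, h2, h3, hact⟩ := P.exists_torsor_patch hβ
    let T : Torsor G F :=
      { X := P.patch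
        p := P.patchStr
        act := act
        act_one := h1
        act_mul := h2
        isPullback := h3
        nonempty := by
          obtain ⟨i⟩ := S.nonempty_index
          exact ⟨(P.toPatch i).left (P.T i).nonempty.some⟩ }
    have hq := P.isPullback_toPatch hβ
    let e (i : I) : ((S.torsorBaseChange G).obj T).T i ≅ P.T i :=
      Torsor.isoMk ((isPullback_torsorProj S T i).isoIsPullback _ _ (hq i))
        (IsPullback.isoIsPullback_hom_snd _ _ _ _) (by
          apply (hq i).hom_ext
          · rw [Category.assoc, Category.assoc, IsPullback.isoIsPullback_hom_fst, ← hact,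
              ← comp_whiskerRight_assoc, IsPullback.isoIsPullback_hom_fst]
            exact act_torsorProj S T i
          · rw [Category.assoc, Category.assoc, IsPullback.isoIsPullback_hom_snd,
              ← Torsor.isPullback _ |>.w, ← Torsor.isPullback _ |>.w, whiskerRight_fst_assoc,
              IsPullback.isoIsPullback_hom_snd])
    have he (i : I) : (e i).hom.hom ≫ P.toPatch i = torsorProj S T i :=
      IsPullback.isoIsPullback_hom_fst _ _ _ _
    refine ⟨T, ⟨TorsorPatchingProblem.isoMk e fun {i j} h => ?_⟩⟩
    apply Torsor.hom_ext
    apply (hq j).hom_ext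
    · rw [Torsor.comp_hom, Torsor.comp_hom, Category.assoc, Category.assoc, he, ← trans_toPatch P h,
        ν_hom_torsorProj, ← Category.assoc (P.ν h).hom.hom, ν_hom_trans, ← Category.assoc,
        Torsor.map_proj, Category.assoc, he]
    · rw [Torsor.Hom.w, Torsor.Hom.w]

end TorsorPatching

theorem mainTheorem4 {F : Type u} [Field F] {I : Type} [Finite I] [PartialOrder I]
    (S : TorsorPatching.FactorizationInverseSystem F I)
    (G : Over (Spec (CommRingCat.of F))) [GrpObj G] [IsAffineHom G.hom] [Smooth G.hom]
    (hβ : S.vectBaseChange.IsEquivalence) :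
    (S.torsorBaseChange G).IsEquivalence ∧
    (∀ P : TorsorPatching.TorsorPatchingProblem S G, ∃ T : TorsorPatching.Torsor G F,
      Nonempty ((S.torsorBaseChange G).obj T ≅ P) ∧
      ∀ T' : TorsorPatching.Torsor G F,
        Nonempty ((S.torsorBaseChange G).obj T' ≅ P) → Nonempty (T' ≅ T)) ∧
    (∀ (P : TorsorPatching.TorsorPatchingProblem S G) (T : TorsorPatching.Torsor G F)
      (e : (S.torsorBaseChange G).obj T ≅ P),
      IsAffine T.X.left ∧ (∀ i, IsAffine (P.T i).X.left) ∧
      TorsorPatching.IsInverseLimit (fun {_ _} h => P.res h)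
        (fun i => TorsorPatching.solutionRes e i)) := by
  have hs : (S.torsorBaseChange G).EssSurj := TorsorPatching.essSurj_torsorBaseChange hβ.essSurj
  have hf : (S.torsorBaseChange G).Full := TorsorPatching.full_torsorBaseChange
  have hff : (S.torsorBaseChange G).Faithful := TorsorPatching.faithful_torsorBaseChange
  refine ⟨{}, fun P => ⟨(S.torsorBaseChange G).objPreimage P,
    ⟨(S.torsorBaseChange G).objObjPreimageIso P⟩, fun T' ⟨e⟩ =>
      ⟨(S.torsorBaseChange G).preimageIso
        (e ≪≫ ((S.torsorBaseChange G).objObjPreimageIso P).symm)⟩⟩,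
    fun P T e => ⟨T.isAffine, fun i => (P.T i).isAffine,
      TorsorPatching.isInverseLimit_solutionRes e⟩⟩
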